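/- All graphs are finite and simple, and a graph is \emph{$F$-free} if no induced subgraph of it is isomorphic to $F$ (and $\mathcal F$-free, for a set $\mathcal F$ of graphs, if it is $F$-free for every $F\in\mathcal F$). A graph is \emph{3-connected} if it has more than three vertices and deleting any set of at most two vertices leaves a connected graph. A \emph{wheel} is a graph formed by a chordless cycle $C$ (of length at least $3$) and a vertex $u$ not in $C$ that has at least three neighbors in $C$; in particular $K_4$ is a wheel. A graph is \emph{wheel-free} if no induced subgraph of it is a wheel. The \emph{claw} is $K_{1,3}$, the \emph{diamond} is $K_4$ minus one edge, and the \emph{butterfly} is the graph formed by two triangles sharing exactly one vertex. A graph is \emph{basic} if it is isomorphic to the line graph of a graph $H$ such that either $H$ is $K_{2,3}$, or $H$ can be obtained from a 3-connected cubic planar graph by subdividing every edge exactly once. Theorem. Let $G$ be a graph. The following statements are equivalent. (1) $G$ is basic. (2) $G$ is 3-connected, wheel-free and planar, and $G$ is a line graph. (3) $G$ is 3-connected, planar and $\{K_4, \text{claw}, \text{diamond}, \text{butterfly}\}$-free. -/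

import Mathlib

namespace SimpleGraph

universe u v

/-- `G` is `k`-connected: it has more than `k` vertices, and deleting fewer than `k` vertices
always leaves a connected graph. -/
def IsVertexConnected {V : Type u} (G : SimpleGraph V) (k : ℕ) : Prop :=
  (k : ℕ∞) < ENat.card V ∧
    ∀ S : Finset V, S.card < k → (G.induce {v : V | v ∉ S}).Connected

/-- Every vertex has exactly three neighbors. -/
def IsCubic {V : Type u} (G : SimpleGraph V) : Prop :=
  ∀ v : V, (G.neighborSet v).encard = 3

/-- `A` is a simple arc in the Euclidean plane with end points `x` and `y`. -/
def IsArcBetween (x y : EuclideanSpace ℝ (Fin 2)) (A : Set (EuclideanSpace ℝ (Fin 2))) : Prop :=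
  ∃ γ : _root_.Path x y, Function.Injective γ ∧ Set.range γ = A

/-- A drawing of `G` in the plane without crossings: vertices are distinct points, every edge
is a simple arc between its two ends, an arc contains no vertex other than its ends, and two
different arcs meet only in common ends. (The values of `arc` on non-edges are irrelevant.) -/
structure PlaneDrawing {V : Type u} (G : SimpleGraph V) where
  point : V → EuclideanSpace ℝ (Fin 2)
  arc : Sym2 V → Set (EuclideanSpace ℝ (Fin 2))
  point_injective : Function.Injective point
  isArc : ∀ v w : V, G.Adj v w → IsArcBetween (point v) (point w) (arc s(v, w))
  mem_of_point_mem : ∀ e ∈ G.edgeSet, ∀ v : V, point v ∈ arc e → v ∈ e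
  arc_inter : ∀ e ∈ G.edgeSet, ∀ f ∈ G.edgeSet, e ≠ f →
    ∀ p ∈ arc e ∩ arc f, ∃ v : V, v ∈ e ∧ v ∈ f ∧ point v = p

/-- A graph is planar if it can be drawn in the plane without crossings. -/
def IsPlanar {V : Type u} (G : SimpleGraph V) : Prop :=
  Nonempty G.PlaneDrawing

/-- The graph obtained from `G` by subdividing every edge exactly once: the new vertices are
the edges of `G`, each adjacent to its two ends. -/
def subdivision {V : Type u} (G : SimpleGraph V) : SimpleGraph (V ⊕ G.edgeSet) where
  Adj
    | Sum.inl v, Sum.inr e => v ∈ (e : Sym2 V)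
    | Sum.inr e, Sum.inl v => v ∈ (e : Sym2 V)
    | _, _ => False
  symm := ⟨by rintro (v | e) (w | f) h <;> exact h⟩
  loopless := ⟨by rintro (v | e) h <;> exact h⟩

/-- `G` is a wheel: a chordless cycle together with one further vertex `u` (the center) that
has at least three neighbors in the cycle. -/
def IsWheel {V : Type u} (G : SimpleGraph V) : Prop :=
  ∃ u : V, (∃ n : ℕ, 3 ≤ n ∧ Nonempty (G.induce {v : V | v ≠ u} ≃g cycleGraph n)) ∧
    3 ≤ (G.neighborSet u).encard

/-- No induced subgraph of `G` is a wheel. -/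
def IsWheelFree {V : Type u} (G : SimpleGraph V) : Prop :=
  ∀ S : Set V, ¬ (G.induce S).IsWheel

/-- `G` is `F`-free: no induced subgraph of `G` is isomorphic to `F`. -/
def IsInducedFree {V : Type u} {W : Type v} (G : SimpleGraph V) (F : SimpleGraph W) : Prop :=
  ¬ F.IsIndContained G

/-- `G` is (isomorphic to) the line graph of a finite simple graph. -/
def IsLineGraph {V : Type u} (G : SimpleGraph V) : Prop :=
  ∃ (W : Type u) (_ : Finite W) (R : SimpleGraph W), Nonempty (G ≃g R.lineGraph)

/-- `G` is basic: it is the line graph of `K_{2,3}`, or of a graph obtained from a 3-connected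
cubic planar graph by subdividing every edge exactly once. -/
def IsBasic {V : Type u} (G : SimpleGraph V) : Prop :=
  Nonempty (G ≃g (completeBipartiteGraph (Fin 2) (Fin 3)).lineGraph) ∨
    ∃ (W : Type u) (_ : Finite W) (H : SimpleGraph W),
      H.IsVertexConnected 3 ∧ H.IsCubic ∧ H.IsPlanar ∧ Nonempty (G ≃g H.subdivision.lineGraph)

/-- The claw `K_{1,3}`. -/
def claw : SimpleGraph (Fin 1 ⊕ Fin 3) := completeBipartiteGraph (Fin 1) (Fin 3)

/-- The diamond: `K_4` minus one edge. -/
def diamond : SimpleGraph (Fin 4) :=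
  fromEdgeSet {s(0, 1), s(0, 2), s(1, 2), s(1, 3), s(2, 3)}

/-- The butterfly: two triangles sharing exactly one vertex. -/
def butterfly : SimpleGraph (Fin 5) :=
  fromEdgeSet {s(0, 1), s(0, 2), s(1, 2), s(0, 3), s(0, 4), s(3, 4)}

end SimpleGraph

namespace SimpleGraph

universe u v

/-! All three statements pass through one local condition, `IsLocallyTriangular`: every vertex has
exactly three neighbors, and exactly two of these are adjacent. The theorem splits into showing that
3-connected graphs as in (2) or (3) satisfy this condition, and classifying the 3-connected planar
graphs that do.

For (3), 3-connectivity gives degree at least three, and the four forbidden subgraphs leave no other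
neighborhood (`isLocallyTriangular_of_free`). For (2), let the graph be the line graph of `R`.
Degree four in `R` yields a `K_4`. An edge `xy` of `R` with two further edges at each end yields a
wheel: 3-connectivity provides two edge-disjoint `x`-`y` paths avoiding `xy`, which form a cycle of
`R`, hence an induced cycle of the line graph, and `xy` is adjacent to at least three edges of it
(`IsWheelFree.root_edge`). So each edge of `R` has two further edges at one end and one at the
other. Conversely, local triangularity excludes wheels and the four forbidden graphs.

In a locally triangular graph the triangles partition the vertices, and each vertex has one edge
leaving its triangle. Hence the graph is a `Truncation`: a loopless cubic multigraph with each
vertex replaced by a triangle. If the multigraph is simple, this is the line graph of its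
subdivision. If it has parallel edges, the third edges at their two ends would give a 2-vertex cut,
unless the multigraph is just three parallel edges; its truncation is the prism, which is the line
graph of `K_{2,3}`.

It remains to carry 3-connectivity and planarity between a truncation and its contraction. For
connectivity, vertex cuts of the contraction are turned into edge cuts and counted. For planarity, a
triangle is contracted to one of its corners, and a vertex is expanded into a triangle inscribed in
a small circle around it. -/

/-- Every neighborhood consists of an edge and an isolated vertex. -/
def IsLocallyTriangular {V : Type u} (G : SimpleGraph V) : Prop :=
  ∀ v, ∃ a b c, G.neighborSet v = {a, b, c} ∧ G.Adj a b ∧ ¬ G.Adj a c ∧ ¬ G.Adj b c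

/-- `G` arises from a cubic multigraph with vertex set `W` by replacing every vertex by a triangle:
`base` sends a corner to its triangle, and `mate` sends it to the other end of its edge. -/
structure Truncation {V : Type u} (G : SimpleGraph V) (W : Type v) where
  base : V → W
  mate : V → V
  mate_mate : ∀ v, mate (mate v) = v
  base_mate : ∀ v, base (mate v) ≠ base v
  adj_iff : ∀ u v, G.Adj u v ↔ (u ≠ v ∧ base u = base v) ∨ mate u = v
  fiber : ∀ w, (base ⁻¹' {w}).encard = 3

/-! ### Forbidden induced subgraphs and the local condition -/

section Free

variable {V : Type u} {G : SimpleGraph V}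

/-- Fewer than `k` vertices cannot cover the neighborhood of `v`, since deleting them (but not `v`)
would isolate `v` from the rest, which is nonempty as there are more than `k` vertices. Repeated use
produces `k` distinct neighbors. -/
theorem IsVertexConnected.exists_adj_notMem {k : ℕ} (h : G.IsVertexConnected k) (v : V)
    (S : Finset V) (hS : S.card < k) : ∃ w, G.Adj v w ∧ w ∉ S := by
  classical
  have hT : (S.erase v).card < k := lt_of_le_of_lt (Finset.card_erase_le) hS
  have hc : (insert v S).card ≤ k := (Finset.card_insert_le _ _).trans hS
  obtain ⟨u, hu⟩ : ∃ u, u ∉ insert v S := by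
    by_contra! hall
    have : ENat.card V ≤ k := by
      rw [← Set.encard_univ]
      calc (Set.univ : Set V).encard ≤ ((insert v S : Finset V) : Set V).encard :=
            Set.encard_le_encard (fun x _ => hall x)
        _ = _ := Set.encard_coe_eq_coe_finsetCard _
        _ ≤ k := by exact_mod_cast hc
    exact absurd h.1 (not_lt.mpr this)
  rw [Finset.mem_insert, not_or] at hu
  have hv : v ∈ {x | x ∉ S.erase v} := by simp
  have hu' : u ∈ {x | x ∉ S.erase v} := by simp [hu]
  obtain ⟨p⟩ := (h.2 _ hT).preconnected ⟨v, hv⟩ ⟨u, hu'⟩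
  cases p with
  | nil => exact absurd rfl hu.1
  | @cons _ w _ hw p =>
    have hw' : G.Adj v w.1 := hw
    exact ⟨w.1, hw', fun hwS => w.2 (Finset.mem_erase.2 ⟨hw'.ne', hwS⟩)⟩

theorem not_isInducedFree_of_map {W : Type v} {F : SimpleGraph W} (f : W → V)
    (hf : Function.Injective f) (h : ∀ a b, G.Adj (f a) (f b) ↔ F.Adj a b) :
    ¬ G.IsInducedFree F :=
  not_not.2 ⟨⟨⟨f, hf⟩, fun {a b} => h a b⟩⟩

theorem IsInducedFree.no_K4 (h : G.IsInducedFree (⊤ : SimpleGraph (Fin 4))) {a b c d : V}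
    (hab : G.Adj a b) (hac : G.Adj a c) (had : G.Adj a d) (hbc : G.Adj b c) (hbd : G.Adj b d)
    (hcd : G.Adj c d) : False := by
  have := hab.ne; have := hac.ne; have := had.ne; have := hbc.ne; have := hbd.ne; have := hcd.ne
  refine not_isInducedFree_of_map (F := ⊤) ![a, b, c, d] ?_ ?_ h
  · intro i j; fin_cases i <;> fin_cases j <;> simp_all [eq_comm]
  · intro i j; fin_cases i <;> fin_cases j <;> simp_all [adj_comm]

theorem IsInducedFree.no_diamond (h : G.IsInducedFree diamond) {a b c d : V}
    (hab : G.Adj a b) (hac : G.Adj a c) (hbc : G.Adj b c) (hbd : G.Adj b d) (hcd : G.Adj c d)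
    (had : ¬ G.Adj a d) (hne : a ≠ d) : False := by
  have := hab.ne; have := hac.ne; have := hbc.ne; have := hbd.ne; have := hcd.ne
  refine not_isInducedFree_of_map (F := diamond) ![a, b, c, d] ?_ ?_ h
  · intro i j; fin_cases i <;> fin_cases j <;> simp_all [eq_comm]
  · intro i j; fin_cases i <;> fin_cases j <;> simp_all [adj_comm, diamond]

theorem IsInducedFree.no_claw (h : G.IsInducedFree claw) {a b c d : V}
    (hab : G.Adj a b) (hac : G.Adj a c) (had : G.Adj a d) (hbc : ¬ G.Adj b c) (hbd : ¬ G.Adj b d)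
    (hcd : ¬ G.Adj c d) (nbc : b ≠ c) (nbd : b ≠ d) (ncd : c ≠ d) : False := by
  have := hab.ne; have := hac.ne; have := had.ne
  refine not_isInducedFree_of_map (F := claw) (Sum.elim ![a] ![b, c, d]) ?_ ?_ h
  · rintro (i | i) (j | j) <;> fin_cases i <;> fin_cases j <;> simp_all [eq_comm]
  · rintro (i | i) (j | j) <;> fin_cases i <;> fin_cases j <;> simp_all [adj_comm, claw]

theorem IsInducedFree.no_butterfly (h : G.IsInducedFree butterfly) {a b c d e : V}
    (hab : G.Adj a b) (hac : G.Adj a c) (hbc : G.Adj b c) (had : G.Adj a d) (hae : G.Adj a e)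
    (hde : G.Adj d e) (hbd : ¬ G.Adj b d) (hbe : ¬ G.Adj b e) (hcd : ¬ G.Adj c d)
    (hce : ¬ G.Adj c e) : False := by
  have := hab.ne; have := hac.ne; have := had.ne; have := hae.ne; have := hbc.ne; have := hde.ne
  have nbd : b ≠ d := fun h => hbe (h ▸ hde)
  have nbe : b ≠ e := fun h => hbd (h ▸ hde.symm)
  have ncd : c ≠ d := fun h => hce (h ▸ hde)
  have nce : c ≠ e := fun h => hcd (h ▸ hde.symm)
  refine not_isInducedFree_of_map (F := butterfly) ![a, b, c, d, e] ?_ ?_ h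
  · intro i j; fin_cases i <;> fin_cases j <;> simp_all [eq_comm]
  · intro i j; fin_cases i <;> fin_cases j <;> simp_all [adj_comm, butterfly]

/-- Among three neighbors of `v` some two are adjacent, as there is no claw; a second adjacency
would give a diamond or `K_4`. A fourth neighbor would be adjacent to neither end of that edge, and
so would complete a butterfly or a claw, according to whether it is adjacent to the third neighbor.
-/
theorem isLocallyTriangular_of_free (hG : G.IsVertexConnected 3)
    (hK : G.IsInducedFree (⊤ : SimpleGraph (Fin 4))) (hC : G.IsInducedFree claw)
    (hD : G.IsInducedFree diamond) (hB : G.IsInducedFree butterfly) :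
    G.IsLocallyTriangular := by
  classical
  intro v
  obtain ⟨x, hx, -⟩ := hG.exists_adj_notMem v ∅ (by simp)
  obtain ⟨y, hy, hyx⟩ := hG.exists_adj_notMem v {x} (by simp)
  obtain ⟨z, hz, hzS⟩ := hG.exists_adj_notMem v {x, y} (Finset.card_le_two.trans_lt (by simp))
  simp only [Finset.mem_singleton, Finset.mem_insert, not_or] at hyx hzS
  have key : ∀ a b c, G.Adj v a → G.Adj v b → G.Adj v c → c ≠ a → c ≠ b → G.Adj a b →
      ¬ G.Adj a c ∧ ¬ G.Adj b c := by
    intro a b c ha hb hc hca hcb hab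
    by_cases h1 : G.Adj a c <;> by_cases h2 : G.Adj b c
    · exact (hK.no_K4 ha hb hc hab h1 h2).elim
    · exact (hD.no_diamond hb.symm hab.symm ha hc h1 h2 hcb.symm).elim
    · exact (hD.no_diamond ha.symm hab hb hc h2 h1 hca.symm).elim
    · exact ⟨h1, h2⟩
  have fin : ∀ a b c, G.Adj v a → G.Adj v b → G.Adj v c → c ≠ a → c ≠ b → G.Adj a b →
      ∃ a b c, G.neighborSet v = {a, b, c} ∧ G.Adj a b ∧ ¬ G.Adj a c ∧ ¬ G.Adj b c := by
    intro a b c ha hb hc hca hcb hab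
    obtain ⟨h1, h2⟩ := key a b c ha hb hc hca hcb hab
    refine ⟨a, b, c, ?_, hab, h1, h2⟩
    ext w
    simp only [mem_neighborSet, Set.mem_insert_iff, Set.mem_singleton_iff]
    refine ⟨fun hw => ?_, by rintro (rfl | rfl | rfl) <;> assumption⟩
    by_contra! hn
    obtain ⟨h3, h4⟩ := key a b w ha hb hw hn.1 hn.2.1 hab
    by_cases hcw : G.Adj c w
    · exact hB.no_butterfly ha hb hab hc hw hcw h1 h3 h2 h4
    · exact hC.no_claw ha hc hw h1 h3 hcw hca.symm hn.1.symm hn.2.2.symm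
  by_cases hxy : G.Adj x y
  · exact fin x y z hx hy hz hzS.1 hzS.2 hxy
  by_cases hxz : G.Adj x z
  · exact fin x z y hx hz hy hyx (Ne.symm hzS.2) hxz
  by_cases hyz : G.Adj y z
  · exact fin y z x hy hz hx (Ne.symm hyx) (Ne.symm hzS.1) hyz
  exact (hC.no_claw hx hy hz hxy hxz hyz (Ne.symm hyx) (Ne.symm hzS.1) (Ne.symm hzS.2)).elim

/-- In a locally triangular graph, two of any three neighbors of a vertex are adjacent, and the
third one is not adjacent to them. -/
theorem IsLocallyTriangular.trichotomy (h : G.IsLocallyTriangular) {v x y z : V}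
    (hx : G.Adj v x) (hy : G.Adj v y) (hz : G.Adj v z) (hxy : x ≠ y) (hxz : x ≠ z) (hyz : y ≠ z) :
    (∀ w, G.Adj v w → w = x ∨ w = y ∨ w = z) ∧
    ((G.Adj x y ∧ ¬ G.Adj x z ∧ ¬ G.Adj y z) ∨ (¬ G.Adj x y ∧ G.Adj x z ∧ ¬ G.Adj y z) ∨
      (¬ G.Adj x y ∧ ¬ G.Adj x z ∧ G.Adj y z)) := by
  obtain ⟨a, b, c, hN, hab, hac, hbc⟩ := h v
  have hm : ∀ w, G.Adj v w ↔ w = a ∨ w = b ∨ w = c := by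
    intro w; rw [← mem_neighborSet, hN]; simp
  have hba := hab.symm
  have hca : ¬ G.Adj c a := fun h => hac h.symm
  have hcb : ¬ G.Adj c b := fun h => hbc h.symm
  simp only [hm] at hx hy hz ⊢
  rcases hx with rfl | rfl | rfl <;> rcases hy with rfl | rfl | rfl <;>
    rcases hz with rfl | rfl | rfl <;> first | (exact absurd rfl ‹_›) | (constructor <;> tauto)

theorem IsLocallyTriangular.isInducedFree_K4 (h : G.IsLocallyTriangular) :
    G.IsInducedFree (⊤ : SimpleGraph (Fin 4)) := by
  rintro ⟨f⟩
  have hA : ∀ i j, i ≠ j → G.Adj (f i) (f j) := fun i j hij => f.map_adj_iff.2 (by simpa using hij)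
  have := (h.trichotomy (hA 0 1 (by decide)) (hA 0 2 (by decide)) (hA 0 3 (by decide))
    (hA 1 2 (by decide)).ne (hA 1 3 (by decide)).ne (hA 2 3 (by decide)).ne).2
  have := hA 1 2 (by decide); have := hA 1 3 (by decide); have := hA 2 3 (by decide)
  tauto

theorem IsLocallyTriangular.isInducedFree_claw (h : G.IsLocallyTriangular) :
    G.IsInducedFree claw := by
  rintro ⟨f⟩
  have hA : ∀ i j, G.Adj (f i) (f j) ↔ claw.Adj i j := fun i j => f.map_adj_iff
  have hne : ∀ i j, i ≠ j → f i ≠ f j := fun i j hij h' => hij (f.injective h')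
  have := (h.trichotomy (v := f (.inl 0)) (x := f (.inr 0)) (y := f (.inr 1)) (z := f (.inr 2))
    ((hA _ _).2 (by simp [claw])) ((hA _ _).2 (by simp [claw])) ((hA _ _).2 (by simp [claw]))
    (hne _ _ (by decide))
    (hne _ _ (by decide)) (hne _ _ (by decide))).2
  simp only [hA] at this
  simp [claw] at this

theorem IsLocallyTriangular.isInducedFree_diamond (h : G.IsLocallyTriangular) :
    G.IsInducedFree diamond := by
  rintro ⟨f⟩
  have hA : ∀ i j, G.Adj (f i) (f j) ↔ diamond.Adj i j := fun i j => f.map_adj_iff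
  have hne : ∀ i j, i ≠ j → f i ≠ f j := fun i j hij h' => hij (f.injective h')
  have := (h.trichotomy (v := f 1) (x := f 0) (y := f 2) (z := f 3)
    ((hA _ _).2 (by simp [diamond])) ((hA _ _).2 (by simp [diamond]))
    ((hA _ _).2 (by simp [diamond])) (hne _ _ (by decide))
    (hne _ _ (by decide)) (hne _ _ (by decide))).2
  simp only [hA] at this
  simp [diamond] at this

theorem IsLocallyTriangular.isInducedFree_butterfly (h : G.IsLocallyTriangular) :
    G.IsInducedFree butterfly := by
  rintro ⟨f⟩
  have hA : ∀ i j, G.Adj (f i) (f j) ↔ butterfly.Adj i j := fun i j => f.map_adj_iff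
  have hne : ∀ i j, i ≠ j → f i ≠ f j := fun i j hij h' => hij (f.injective h')
  have := (h.trichotomy (v := f 0) (x := f 1) (y := f 2) (z := f 3)
    ((hA _ _).2 (by simp [butterfly])) ((hA _ _).2 (by simp [butterfly]))
    ((hA _ _).2 (by simp [butterfly]))
    (hne _ _ (by decide)) (hne _ _ (by decide)) (hne _ _ (by decide))).1 (f 4)
    ((hA _ _).2 (by simp [butterfly]))
  simp only [f.injective.eq_iff] at this
  revert this; decide

/-- The hub has degree three, so its isolated neighbor `c` lies on the rim. The neighbors of `c` are
the hub and its two rim neighbors. The hub is adjacent to neither of those, so they are adjacent to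
each other and the rim is a triangle; but then `c` is adjacent to the other neighbors of the hub. -/
theorem IsLocallyTriangular.isWheelFree (h : G.IsLocallyTriangular) : G.IsWheelFree := by
  classical
  rintro S ⟨u, ⟨n, hn, ⟨φ⟩⟩, hu⟩
  obtain ⟨m, rfl⟩ : ∃ m, n = m + 3 := ⟨n - 3, by omega⟩
  -- the rim as a map into `G`
  set f : Fin (m + 3) → V := fun i => (φ.symm i).1.1 with hf
  have finj : Function.Injective f := fun i j hij =>
    φ.symm.injective (Subtype.ext (Subtype.ext hij))
  have fadj : ∀ i j, G.Adj (f i) (f j) ↔ (cycleGraph (m + 3)).Adj i j := fun i j =>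
    φ.symm.map_adj_iff
  have fne : ∀ i, f i ≠ u.1 := fun i h' => (φ.symm i).2 (Subtype.ext h')
  have fsurj : ∀ w : S, w ≠ u → ∃ i, f i = w.1 := fun w hw => ⟨φ ⟨w, hw⟩, by
    simp only [hf]; rw [φ.symm_apply_apply]⟩
  have h1 : ∀ i : Fin (m + 3), G.Adj (f i) (f (i + 1)) := fun i => by
    rw [fadj, cycleGraph_adj]; right; simp
  have h2 : ∀ i : Fin (m + 3), G.Adj (f i) (f (i - 1)) := fun i => by
    rw [fadj, cycleGraph_adj]; left; simp
  obtain ⟨T, hT, hT3⟩ := Set.exists_subset_encard_eq hu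
  obtain ⟨x, y, z, hxy, hxz, hyz, rfl⟩ := Set.encard_eq_three.1 hT3
  have hx : G.Adj u.1 x.1 := hT (by simp)
  have hy : G.Adj u.1 y.1 := hT (by simp)
  have hz : G.Adj u.1 z.1 := hT (by simp)
  obtain ⟨a, b, c, hN, hab, hac, hbc⟩ := h u.1
  have hm : ∀ w, G.Adj u.1 w ↔ w = a ∨ w = b ∨ w = c := by
    intro w; rw [← mem_neighborSet, hN]; simp
  -- every neighbor of `u` lies on the rim
  have rim : ∀ w, G.Adj u.1 w → ∃ i, f i = w := by
    intro w hw
    have := (h.trichotomy hx hy hz (Subtype.coe_injective.ne hxy) (Subtype.coe_injective.ne hxz)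
      (Subtype.coe_injective.ne hyz)).1 w hw
    have hn : ∀ t : S, G.Adj u.1 t.1 → t ≠ u := fun t ht h' => ht.ne (by rw [h'])
    rcases this with rfl | rfl | rfl
    exacts [fsurj _ (hn _ hx), fsurj _ (hn _ hy), fsurj _ (hn _ hz)]
  obtain ⟨k, hk⟩ := rim c ((hm c).2 (by simp))
  obtain ⟨i, hi⟩ := rim a ((hm a).2 (by simp))
  have huc : G.Adj (f k) u.1 := by rw [hk]; exact ((hm c).2 (by simp)).symm
  have hne : f (k + 1) ≠ f (k - 1) := fun h' => by
    have h3 : k + 1 = k - 1 := finj h'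
    have h5 : (1 + 1 : Fin (m + 3)) = 0 := by
      rw [← sub_eq_zero.2 h3]; abel
    have h6 := congrArg Fin.val h5
    simp only [Fin.val_add, Fin.val_zero, Fin.val_one] at h6
    rw [Nat.mod_eq_of_lt (by omega)] at h6
    omega
  have ht := (h.trichotomy (h1 k) (h2 k) huc hne (fne _) (fne _)).2
  have nu : ∀ j, G.Adj (f k) (f j) → ¬ G.Adj (f j) u.1 := by
    intro j hj hju
    rcases (hm _).1 hju.symm with h' | h' | h'
    · exact hac (by rw [← h', ← hk]; exact hj.symm)
    · exact hbc (by rw [← h', ← hk]; exact hj.symm)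
    · rw [← hk] at h'; exact hj.ne h'.symm
  have hadj : G.Adj (f (k + 1)) (f (k - 1)) := by
    have := nu _ (h1 k); have := nu _ (h2 k); tauto
  -- the rim is a triangle, so `a` and `c` are adjacent
  have hik : i ≠ k := fun h' => by
    subst h'; rw [hi] at hk; subst hk; exact hbc hab.symm
  -- The positions `k + 1` and `k - 1` differ by two, so they are consecutive only if `1 = 0` or `3
  -- = 0` modulo `m + 3`.
  have hm0 : m = 0 := by
    rw [fadj, cycleGraph_adj] at hadj
    rcases hadj with h' | h'
    · have h3 : (1 : Fin (m + 3)) = 0 := by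
        rw [← sub_eq_zero.2 h']; abel
      simp at h3
    · have h3 : (1 + 1 + 1 : Fin (m + 3)) = 0 := by
        rw [← neg_eq_zero, ← sub_eq_zero.2 h']; abel
      by_contra hm0
      have h6 := congrArg Fin.val h3
      simp only [Fin.val_add, Fin.val_zero, Fin.val_one, Nat.mod_add_mod] at h6
      rw [Nat.mod_eq_of_lt (by omega)] at h6
      omega
  subst hm0
  apply hac
  rw [← hi, ← hk, fadj, cycleGraph_three_eq_top]
  simpa using hik

end Free

/-! ### Truncations of cubic multigraphs -/

namespace Truncation

variable {V : Type u} {W : Type v} {G : SimpleGraph V} (T : Truncation G W)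

/-- The fiber through `v` consists of `v` and two further corners. -/
theorem exists_fiber_eq (v : V) : ∃ a b, v ≠ a ∧ v ≠ b ∧ a ≠ b ∧ T.base a = T.base v ∧
    T.base b = T.base v ∧ ∀ w, T.base w = T.base v → w = v ∨ w = a ∨ w = b := by
  have h3 := T.fiber (T.base v)
  have hv : v ∈ T.base ⁻¹' {T.base v} := rfl
  obtain ⟨x, y, z, hxy, hxz, hyz, hF⟩ := Set.encard_eq_three.1 h3
  have hF' : ∀ w, T.base w = T.base v ↔ w = x ∨ w = y ∨ w = z := fun w => by
    simpa using Set.ext_iff.1 hF w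
  have hx := (hF' x).2 (by simp)
  have hy := (hF' y).2 (by simp)
  have hz := (hF' z).2 (by simp)
  rw [hF] at hv
  rcases hv with rfl | rfl | rfl
  · exact ⟨y, z, hxy, hxz, hyz, hy, hz, fun w hw => (hF' w).1 hw⟩
  · exact ⟨x, z, hxy.symm, hyz, hxz, hx, hz, fun w hw => by have := (hF' w).1 hw; tauto⟩
  · exact ⟨x, y, hxz.symm, hyz.symm, hxy, hx, hy, fun w hw => by have := (hF' w).1 hw; tauto⟩

theorem isLocallyTriangular (T : Truncation G W) : G.IsLocallyTriangular := by
  intro v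
  obtain ⟨a, b, hva, hvb, hab, ha, hb, hF⟩ := T.exists_fiber_eq v
  have hF' : ∀ w, T.base w = T.base v ↔ w = v ∨ w = a ∨ w = b := fun w =>
    ⟨hF w, by rintro (rfl | rfl | rfl) <;> simp [ha, hb]⟩
  have hm := T.base_mate v
  refine ⟨a, b, T.mate v, ?_, ?_, ?_, ?_⟩
  · ext w
    rw [mem_neighborSet, T.adj_iff, eq_comm (a := T.base v), hF', eq_comm (a := T.mate v)]
    simp only [Set.mem_insert_iff, Set.mem_singleton_iff]
    constructor
    · rintro (⟨h1, h2⟩ | h) <;> tauto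
    · rintro (rfl | rfl | rfl) <;> tauto
  · rw [T.adj_iff]; exact .inl ⟨hab, ha.trans hb.symm⟩
  · rw [T.adj_iff]
    rintro (⟨-, h⟩ | h)
    · exact hm (h.symm.trans ha)
    · exact hva (by rw [← T.mate_mate v, ← h, T.mate_mate])
  · rw [T.adj_iff]
    rintro (⟨-, h⟩ | h)
    · exact hm (h.symm.trans hb)
    · exact hvb (by rw [← T.mate_mate v, ← h, T.mate_mate])

theorem base_surjective : Function.Surjective T.base := fun w => by
  have : (T.base ⁻¹' {w}).Nonempty := by
    rw [← Set.encard_ne_zero, T.fiber]; decide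
  exact this

theorem mate_injective : Function.Injective T.mate :=
  Function.LeftInverse.injective T.mate_mate

theorem adj_mate (v : V) : G.Adj v (T.mate v) := (T.adj_iff _ _).2 (.inr rfl)

theorem adj_of_base_eq {u v : V} (hne : u ≠ v) (h : T.base u = T.base v) : G.Adj u v :=
  (T.adj_iff _ _).2 (.inl ⟨hne, h⟩)

/-- The multigraph underlying a truncation is simple. -/
def IsSimple : Prop :=
  ∀ u v, T.base u = T.base v → T.base (T.mate u) = T.base (T.mate v) → u = v

/-- The graph obtained by contracting all triangles of a truncation. -/
def contraction : SimpleGraph W where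
  Adj X Y := ∃ u, T.base u = X ∧ T.base (T.mate u) = Y
  symm := ⟨by rintro X Y ⟨u, rfl, rfl⟩; exact ⟨T.mate u, rfl, by rw [T.mate_mate]⟩⟩
  loopless := ⟨by rintro X ⟨u, rfl, h⟩; exact T.base_mate u h⟩

theorem contraction_adj (u : V) : T.contraction.Adj (T.base u) (T.base (T.mate u)) :=
  ⟨u, rfl, rfl⟩

theorem contraction_isCubic (hT : T.IsSimple) : T.contraction.IsCubic := by
  intro X
  rw [← T.fiber X]
  have : T.contraction.neighborSet X = (fun u => T.base (T.mate u)) '' (T.base ⁻¹' {X}) := by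
    ext Y; rfl
  rw [this, Set.InjOn.encard_image]
  intro u hu v hv huv
  exact hT u v (hu.trans hv.symm) huv

end Truncation

/-- The edge from `v` to its isolated neighbor `c v` is characterized as the one edge at `v` in no
triangle. This is symmetric in its ends, so `c` is an involution and serves as `mate`; the triangles
`{v, a v, b v}` are the classes of an equivalence relation and serve as the vertices of the
multigraph. -/
theorem IsLocallyTriangular.exists_truncation {V : Type u} {G : SimpleGraph V}
    (h : G.IsLocallyTriangular) : ∃ W : Type u, Nonempty (Truncation G W) := by
  choose a b c hN hab hac hbc using h
  have hm : ∀ v w, G.Adj v w ↔ w = a v ∨ w = b v ∨ w = c v := by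
    intro v w; rw [← mem_neighborSet, hN]; simp
  have ha : ∀ v, G.Adj v (a v) := fun v => (hm v _).2 (by simp)
  have hb : ∀ v, G.Adj v (b v) := fun v => (hm v _).2 (by simp)
  have hc : ∀ v, G.Adj v (c v) := fun v => (hm v _).2 (by simp)
  have hbc' : ∀ v, b v ≠ c v := fun v h' => hac v (h' ▸ hab v)
  have hac' : ∀ v, a v ≠ c v := fun v h' => hbc v (h' ▸ (hab v).symm)
  -- `c v` is the only neighbor of `v` sharing no neighbor with `v`
  have cc : ∀ v w, G.Adj v w → (w = c v ↔ ¬ ∃ t, G.Adj v t ∧ G.Adj w t) := by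
    intro v w hvw
    constructor
    · rintro rfl ⟨t, h1, h2⟩
      rcases (hm _ _).1 h1 with rfl | rfl | rfl
      · exact hac _ h2.symm
      · exact hbc _ h2.symm
      · exact h2.ne rfl
    · intro hn
      rcases (hm _ _).1 hvw with rfl | rfl | rfl
      · exact (hn ⟨_, hb v, hab v⟩).elim
      · exact (hn ⟨_, ha v, (hab v).symm⟩).elim
      · rfl
  have ccv : ∀ v, c (c v) = v := fun v => by
    refine ((cc (c v) v (hc v).symm).2 ?_).symm
    rintro ⟨t, h1, h2⟩
    exact (cc v (c v) (hc v)).1 rfl ⟨t, h2, h1⟩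
  let s : Setoid V :=
    { r := fun v w => w = v ∨ w = a v ∨ w = b v
      iseqv :=
        { refl := fun v => .inl rfl
          symm := by
            have key : ∀ v w, G.Adj v w → w ≠ c v → v = a w ∨ v = b w := by
              intro v w hvw hw
              rw [ne_eq, cc v w hvw, not_not] at hw
              obtain ⟨t, h1, h2⟩ := hw
              have : v ≠ c w := by rw [ne_eq, cc w v hvw.symm, not_not]; exact ⟨t, h2, h1⟩
              have := (hm w v).1 hvw.symm
              tauto
            rintro v w (rfl | rfl | rfl)
            · exact .inl rfl
            · exact .inr (key _ _ (ha v) (hac' v))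
            · exact .inr (key _ _ (hb v) (hbc' v))
          trans := by
            -- In a triangle `v x y`, both `v` and `y` differ from `c x`, so they are `a x` and `b
            -- x` in some order.
            have key : ∀ v x y, G.Adj v x → G.Adj v y → G.Adj x y →
                ∀ w, w = x ∨ w = a x ∨ w = b x → w = v ∨ w = x ∨ w = y := by
              intro v x y hx hy hxy w hw
              have hv : v ≠ c x := by
                rw [ne_eq, cc x v hx.symm, not_not]; exact ⟨y, hxy, hy⟩
              have hy' : y ≠ c x := by
                rw [ne_eq, cc x y hxy, not_not]; exact ⟨v, hx.symm, hy.symm⟩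
              have h1 := (hm x v).1 hx.symm
              have h2 := (hm x y).1 hxy
              have h3 := hy.ne
              rcases h1 with h1 | h1 | h1 <;> rcases h2 with h2 | h2 | h2 <;>
                first
                | exact absurd h1 hv
                | exact absurd h2 hy'
                | exact absurd (h1.trans h2.symm) h3
                | (rw [h1, h2]; tauto)
            rintro v w x (rfl | rfl | rfl) hx
            · exact hx
            · have := key v (a v) (b v) (ha v) (hb v) (hab v) x hx; tauto
            · have := key v (b v) (a v) (hb v) (ha v) (hab v).symm x hx; tauto } }
  have hs : ∀ v w, (Quotient.mk s v = Quotient.mk s w) ↔ (w = v ∨ w = a v ∨ w = b v) :=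
    fun v w => Quotient.eq
  refine ⟨Quotient s, ⟨⟨Quotient.mk s, c, ccv, ?_, ?_, ?_⟩⟩⟩
  · intro v h'
    rcases (hs _ _).1 h'.symm with h' | h' | h'
    · exact (hc v).ne h'.symm
    · exact hac' v h'.symm
    · exact hbc' v h'.symm
  · intro v w
    rw [hm, hs]
    have h1 := (ha v).ne
    have h2 := (hb v).ne
    constructor
    · rintro (rfl | rfl | rfl) <;> tauto
    · rintro (⟨h3, rfl | h4 | h4⟩ | rfl) <;> tauto
  · intro w
    induction w using Quotient.inductionOn with
    | h v =>
      have : Quotient.mk s ⁻¹' {Quotient.mk s v} = {v, a v, b v} := by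
        ext w
        rw [Set.mem_preimage, Set.mem_singleton_iff, eq_comm, hs]; rfl
      rw [this, Set.encard_eq_three]
      exact ⟨_, _, _, (ha v).ne, (hb v).ne, (hab v).ne, rfl⟩

/-! ### Truncations as line graphs -/

/-- The graph obtained from `H` by replacing every vertex by a clique: its vertices are the darts
of `H`. -/
def cornerGraph {W : Type v} (H : SimpleGraph W) : SimpleGraph H.Dart where
  Adj d e := (d ≠ e ∧ d.fst = e.fst) ∨ d.symm = e
  symm := ⟨by
    rintro d e (⟨h1, h2⟩ | rfl)
    · exact .inl ⟨h1.symm, h2.symm⟩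
    · exact .inr (by simp)⟩
  loopless := ⟨by
    rintro d (⟨h, -⟩ | h)
    · exact h rfl
    · exact d.symm_ne h⟩

/-- A cubic graph truncates to its corner graph. -/
def IsCubic.truncation {W : Type v} {H : SimpleGraph W} (hH : H.IsCubic) :
    Truncation H.cornerGraph W where
  base d := d.fst
  mate d := d.symm
  mate_mate d := d.symm_symm
  base_mate d := d.adj.ne'
  adj_iff _ _ := Iff.rfl
  fiber w := by
    rw [← hH w]
    have : H.neighborSet w = (fun d : H.Dart => d.snd) '' ((fun d : H.Dart => d.fst) ⁻¹' {w}) := by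
      ext x
      constructor
      · intro hx; exact ⟨⟨(w, x), hx⟩, rfl, rfl⟩
      · rintro ⟨d, rfl, rfl⟩; exact d.adj
    rw [this, Set.InjOn.encard_image]
    intro d hd e he hde
    exact Dart.ext _ _ (Prod.ext (hd.trans he.symm) hde)

theorem IsCubic.truncation_contraction {W : Type v} {H : SimpleGraph W} (hH : H.IsCubic) :
    hH.truncation.contraction = H := by
  ext x y
  constructor
  · rintro ⟨d, rfl, rfl⟩; exact d.adj
  · intro h; exact ⟨⟨(x, y), h⟩, rfl, rfl⟩

theorem IsCubic.truncation_isSimple {W : Type v} {H : SimpleGraph W} (hH : H.IsCubic) :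
    hH.truncation.IsSimple := fun _ _ h1 h2 => Dart.ext _ _ (Prod.ext h1 h2)

/-- Without parallel edges a corner is determined by its triangle and that of its mate, that is, by
a dart of the contraction. -/
theorem Truncation.nonempty_iso_cornerGraph {V : Type u} {W : Type v} {G : SimpleGraph V}
    (T : Truncation G W) (hT : T.IsSimple) : Nonempty (G ≃g T.contraction.cornerGraph) := by
  let f : V → T.contraction.Dart := fun u => ⟨(T.base u, T.base (T.mate u)), T.contraction_adj u⟩
  have finj : Function.Injective f := fun u v h => by
    have := congrArg Dart.toProd h
    exact hT u v (congrArg Prod.fst this) (congrArg Prod.snd this)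
  have fsurj : Function.Surjective f := by
    rintro ⟨⟨x, y⟩, h⟩
    obtain ⟨u, hx, hy⟩ := id h
    exact ⟨u, Dart.ext _ _ (Prod.ext hx hy)⟩
  have fmate : ∀ u, (f u).symm = f (T.mate u) := fun u => by
    apply Dart.ext
    simp [f, T.mate_mate]
  refine ⟨⟨Equiv.ofBijective f ⟨finj, fsurj⟩, ?_⟩⟩
  intro u v
  change (f u ≠ f v ∧ T.base u = T.base v) ∨ (f u).symm = f v ↔ _
  rw [T.adj_iff, fmate, finj.eq_iff, finj.ne_iff]

/-- An edge of the subdivision is half of an edge of `H`, hence a dart. Two halves meet in an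
original vertex if the darts start together, and in a subdividing vertex if the darts are opposite.
-/
theorem nonempty_cornerGraph_iso_lineGraph {W : Type v} (H : SimpleGraph W) :
    Nonempty (H.cornerGraph ≃g H.subdivision.lineGraph) := by
  let f : H.Dart → H.subdivision.edgeSet := fun d =>
    ⟨s(.inl d.fst, .inr ⟨d.edge, d.edge_mem⟩), by
      change d.fst ∈ d.edge
      simp [Dart.edge]⟩
  have finj : Function.Injective f := by
    intro d e h
    have h1 := congrArg Subtype.val h
    simp only [f, Sym2.eq_iff, Sum.inl.injEq, Sum.inr.injEq, Subtype.mk.injEq, reduceCtorEq,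
      false_and, or_false] at h1
    rcases (dart_edge_eq_iff d e).1 h1.2 with rfl | rfl
    · rfl
    · exact absurd h1.1 e.adj.ne'
  have fsurj : Function.Surjective f := by
    rintro ⟨e, he⟩
    induction e using Sym2.ind with
    | _ x y =>
      have key : ∀ (v : W) (e : H.edgeSet), v ∈ (e : Sym2 W) →
          ∃ d : H.Dart, d.fst = v ∧ d.edge = e := by
        rintro v ⟨e, he⟩ hv
        obtain ⟨w, rfl⟩ := Sym2.mem_iff_exists.1 hv
        exact ⟨⟨(v, w), he⟩, rfl, rfl⟩
      rcases x with x | x <;> rcases y with y | y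
      · exact he.elim
      · obtain ⟨d, rfl, hd⟩ := key x y he
        exact ⟨d, Subtype.ext (by simp [f, hd])⟩
      · obtain ⟨d, rfl, hd⟩ := key y x he
        exact ⟨d, Subtype.ext (by simp [f, hd])⟩
      · exact he.elim
  refine ⟨⟨Equiv.ofBijective f ⟨finj, fsurj⟩, ?_⟩⟩
  intro d e
  change H.subdivision.lineGraph.Adj (f d) (f e) ↔ (d ≠ e ∧ d.fst = e.fst) ∨ d.symm = e
  rw [lineGraph_adj_iff_exists, finj.ne_iff]
  constructor
  · rintro ⟨hne, x, h1, h2⟩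
    simp only [f, Sym2.mem_iff] at h1 h2
    rcases h1 with rfl | rfl
    · simp only [Sum.inl.injEq, reduceCtorEq, or_false] at h2
      exact .inl ⟨hne, h2⟩
    · simp only [Sum.inr.injEq, Subtype.mk.injEq, reduceCtorEq, false_or] at h2
      rcases (dart_edge_eq_iff d e).1 h2 with rfl | rfl
      · exact absurd rfl hne
      · right; simp
  · rintro (⟨hne, h⟩ | rfl)
    · exact ⟨hne, .inl d.fst, by simp [f], by simp [f, h]⟩
    · exact ⟨d.symm_ne.symm, .inr ⟨d.edge, d.edge_mem⟩, by simp [f], by simp [f]⟩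

/-- The triangular prism. -/
def prism : SimpleGraph (Fin 2 × Fin 3) where
  Adj p q := (p ≠ q ∧ p.1 = q.1) ∨ (p.1 ≠ q.1 ∧ p.2 = q.2)
  symm := ⟨by rintro p q h; simpa only [ne_comm, eq_comm] using h⟩
  loopless := ⟨by rintro p h; simp at h⟩

/-- The prism is the truncation of two vertices joined by three parallel edges. -/
def prismTruncation : Truncation prism (Fin 2) where
  base p := p.1
  mate p := (1 - p.1, p.2)
  mate_mate p := by simp
  base_mate := by decide
  adj_iff := by
    change ∀ u v : Fin 2 × Fin 3, ((u ≠ v ∧ u.1 = v.1) ∨ (u.1 ≠ v.1 ∧ u.2 = v.2)) ↔ _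
    decide
  fiber w := by
    rw [Set.encard_eq_three]
    refine ⟨(w, 0), (w, 1), (w, 2), by simp, by simp, by simp, ?_⟩
    ext ⟨i, j⟩
    simp only [Set.mem_preimage, Set.mem_singleton_iff, Set.mem_insert_iff, Prod.mk.injEq]
    revert i j w; decide

theorem nonempty_prism_iso_lineGraph :
    Nonempty (prism ≃g (completeBipartiteGraph (Fin 2) (Fin 3)).lineGraph) := by
  let f : Fin 2 × Fin 3 → (completeBipartiteGraph (Fin 2) (Fin 3)).edgeSet := fun p =>
    ⟨s(.inl p.1, .inr p.2), by simp⟩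
  have finj : Function.Injective f := by
    intro p q h
    have h1 := congrArg Subtype.val h
    simp only [f, Sym2.eq_iff, Sum.inl.injEq, Sum.inr.injEq, reduceCtorEq,
      false_and, or_false] at h1
    exact Prod.ext h1.1 h1.2
  have fsurj : Function.Surjective f := by
    rintro ⟨e, he⟩
    induction e using Sym2.ind with
    | _ x y =>
      rcases x with x | x <;> rcases y with y | y
      · simp at he
      · exact ⟨(x, y), rfl⟩
      · exact ⟨(y, x), Subtype.ext (by simp [f])⟩
      · simp at he
  refine ⟨⟨Equiv.ofBijective f ⟨finj, fsurj⟩, ?_⟩⟩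
  intro p q
  change (completeBipartiteGraph (Fin 2) (Fin 3)).lineGraph.Adj (f p) (f q) ↔
    (p ≠ q ∧ p.1 = q.1) ∨ (p.1 ≠ q.1 ∧ p.2 = q.2)
  rw [lineGraph_adj_iff_exists, finj.ne_iff]
  obtain ⟨i, j⟩ := p
  obtain ⟨k, l⟩ := q
  simp only [f, Sym2.mem_iff, Sum.exists]
  simp only [Sum.inl.injEq, Sum.inr.injEq, reduceCtorEq, or_false, false_or, exists_eq_left]
  by_cases h : i = k <;> simp [h]

/-! ### 3-connectivity of truncations and contractions -/

section Connectivity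

theorem reachable_induce_of_closed {V : Type u} {G : SimpleGraph V} {s : Set V} {P : V → Prop}
    (hP : ∀ x y, x ∈ s → y ∈ s → P x → G.Adj x y → P y) {x y : s}
    (h : (G.induce s).Reachable x y) (hx : P x) : P y := by
  obtain ⟨p⟩ := h
  induction p with
  | nil => exact hx
  | @cons a b c hab _ ih => exact ih (hP a b a.2 b.2 hx hab)

theorem IsVertexConnected.of_iso {V : Type u} {V' : Type v} {G : SimpleGraph V}
    {G' : SimpleGraph V'} {k : ℕ} (h : G.IsVertexConnected k) (e : G ≃g G') :
    G'.IsVertexConnected k := by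
  classical
  refine ⟨by rw [← ENat.card_congr e.toEquiv]; exact h.1, fun S hS => ?_⟩
  have hc := h.2 (S.map e.symm.toEquiv.toEmbedding) (by rwa [Finset.card_map])
  have hmem : ∀ v, v ∈ {v | v ∉ S.map e.symm.toEquiv.toEmbedding} ↔ e v ∈ {v | v ∉ S} := by
    intro v
    simp only [Set.mem_ofPred_eq, Finset.mem_map, not_iff_not]
    constructor
    · rintro ⟨w, hw, rfl⟩
      have : e (e.symm w) = w := e.apply_symm_apply w
      change e (e.symm w) ∈ S
      rwa [this]
    · intro hv; exact ⟨e v, hv, e.symm_apply_apply v⟩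
  have i : G.induce {v | v ∉ S.map e.symm.toEquiv.toEmbedding} ≃g G'.induce {v | v ∉ S} :=
    ⟨e.toEquiv.subtypeEquiv hmem, fun {a b} => e.map_adj_iff⟩
  exact (i.connected_iff).1 hc

namespace Truncation

variable {V : Type u} {W : Type v} {G : SimpleGraph V} (T : Truncation G W)

theorem exists_finset_fiber (w : W) :
    ∃ F : Finset V, F.card = 3 ∧ ∀ d, d ∈ F ↔ T.base d = w := by
  classical
  obtain ⟨v, rfl⟩ := T.base_surjective w
  obtain ⟨a, b, h1, h2, h3, ha, hb, h⟩ := T.exists_fiber_eq v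
  refine ⟨{v, a, b}, Finset.card_eq_three.2 ⟨_, _, _, h1, h2, h3, rfl⟩, fun d => ?_⟩
  simp only [Finset.mem_insert, Finset.mem_singleton]
  exact ⟨by rintro (rfl | rfl | rfl) <;> simp [ha, hb], h d⟩

/-- Call a triangle touched if it meets the deleted set `S`. At most two are touched, so the
untouched ones are connected to each other through the contraction; it remains to lead each
surviving corner to an untouched triangle. -/
theorem isVertexConnected_three (hT : T.IsSimple) (h : T.contraction.IsVertexConnected 3) :
    G.IsVertexConnected 3 := by
  classical
  refine ⟨h.1.trans_le (ENat.card_le_card_of_injective (Function.injective_surjInv T.base_surjective)), fun S hS => ?_⟩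
  set X := S.image T.base
  have hXc : X.card < 3 := Finset.card_image_le.trans_lt hS
  have hconn := h.2 X hXc
  have hmemX : ∀ d, T.base d ∉ X → d ∉ S := fun d hd hS' => hd (Finset.mem_image_of_mem _ hS')
  set K := G.induce {v | v ∉ S}
  have same : ∀ (u v : V) (hu : u ∉ S) (hv : v ∉ S), T.base u = T.base v →
      K.Reachable ⟨u, hu⟩ ⟨v, hv⟩ := by
    intro u v hu hv huv
    by_cases hne : u = v
    · subst hne; rfl
    · exact Adj.reachable (show G.Adj u v from T.adj_of_base_eq hne huv)
  have mate : ∀ (u : V) (hu : u ∉ S) (hv : T.mate u ∉ S),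
      K.Reachable ⟨u, hu⟩ ⟨T.mate u, hv⟩ := fun u hu hv =>
    Adj.reachable (show G.Adj u (T.mate u) from T.adj_mate u)
  have main : ∀ (u v : V) (hu : T.base u ∉ X) (hv : T.base v ∉ X),
      K.Reachable ⟨u, hmemX u hu⟩ ⟨v, hmemX v hv⟩ := by
    intro u v hu hv
    have hr := hconn.preconnected ⟨_, hu⟩ ⟨_, hv⟩
    refine reachable_induce_of_closed
      (P := fun w => ∀ v (hv : T.base v ∉ X), T.base v = w →
        K.Reachable ⟨u, hmemX u hu⟩ ⟨v, hmemX v hv⟩) ?_ hr ?_ v hv rfl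
    · rintro x y hx hy ih ⟨d, rfl, rfl⟩ v hv' hvd
      have h1 := ih d hx rfl
      exact (h1.trans (mate d (hmemX d hx) (hmemX _ hy))).trans
        (same _ _ (hmemX _ hy) (hmemX v hv') hvd.symm)
    · intro v hv' huv
      exact same _ _ _ _ huv.symm
  -- every surviving corner reaches a corner of an untouched triangle
  have out : ∀ (u : V) (hu : u ∉ S), ∃ (v : V) (hv : T.base v ∉ X),
      K.Reachable ⟨u, hu⟩ ⟨v, hmemX v hv⟩ := by
    intro u hu
    by_cases hx : T.base u ∉ X
    · exact ⟨u, hx, by rfl⟩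
    obtain ⟨F, hF3, hF⟩ := T.exists_finset_fiber (T.base u)
    obtain ⟨d, hdF, hdS, hd⟩ : ∃ d ∈ F, d ∉ S ∧ T.base (T.mate d) ∉ X := by
      by_contra! hall
      -- Distinct corners of `F` lead to distinct triangles by simplicity. If all survivors led to
      -- touched triangles, each would account for its own element of `S` outside `F`, and `S` would
      -- have at least `3` elements.
      have h1 : (F \ S).card ≤ (S \ F).card := by
        calc (F \ S).card ≤ ((S \ F).image T.base).card := by
              refine Finset.card_le_card_of_injOn (fun d => T.base (T.mate d)) ?_ ?_
              · intro d hd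
                rw [Finset.mem_coe, Finset.mem_sdiff] at hd
                obtain ⟨e, he, hed⟩ := Finset.mem_image.1 (hall d hd.1 hd.2)
                refine Finset.mem_coe.2 (Finset.mem_image.2 ⟨e, Finset.mem_sdiff.2 ⟨he, ?_⟩, hed⟩)
                rw [hF, hed, ← (hF d).1 hd.1]
                exact T.base_mate d
              · intro d hd e he hde
                rw [Finset.mem_coe, Finset.mem_sdiff, hF] at hd he
                exact hT d e (hd.1.trans he.1.symm) hde
          _ ≤ _ := Finset.card_image_le
      have h2 := Finset.card_sdiff_add_card_inter F S
      have h3 := Finset.card_sdiff_add_card_inter S F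
      rw [Finset.inter_comm] at h3
      omega
    refine ⟨T.mate d, hd, (same u d hu hdS ((hF d).1 hdF).symm).trans (mate d hdS _)⟩
  refine (connected_iff _).2 ⟨?_, ?_⟩
  · rintro ⟨u, hu⟩ ⟨v, hv⟩
    obtain ⟨u', hu', h1⟩ := out u hu
    obtain ⟨v', hv', h2⟩ := out v hv
    exact (h1.trans (main u' v' hu' hv')).trans h2.symm
  · obtain ⟨⟨w, hw⟩⟩ := hconn.nonempty
    obtain ⟨v, rfl⟩ := T.base_surjective w
    exact ⟨⟨v, hmemX v hw⟩⟩

/-- If a truncation is 3-connected, then every edge cut of the underlying multigraph has at least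
three edges. -/
theorem three_le_card_cut (h : G.IsVertexConnected 3) {P : Set W} {x y : W} (hx : x ∈ P)
    (hy : y ∉ P) (C : Finset V) (hC : ∀ d, T.base d ∈ P → T.base (T.mate d) ∉ P → d ∈ C)
    (hC' : ∀ d ∈ C, T.base d ∈ P) : 3 ≤ C.card := by
  by_contra! hlt
  -- A cut with fewer than three corners cannot use up the triangle over `x`.
  obtain ⟨F, hF3, hF⟩ := T.exists_finset_fiber x
  obtain ⟨d, hd, hdC⟩ := Finset.exists_mem_notMem_of_card_lt_card (hlt.trans_eq hF3.symm)
  obtain ⟨e, rfl⟩ := T.base_surjective y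
  have heC : e ∉ C := fun h => hy (hC' e h)
  have hr := (h.2 C hlt).preconnected ⟨d, hdC⟩ ⟨e, heC⟩
  refine hy (reachable_induce_of_closed (P := fun v => T.base v ∈ P) ?_ hr ?_)
  · intro a b ha hb haP hab
    rcases (T.adj_iff a b).1 hab with ⟨-, h'⟩ | rfl
    · exact h' ▸ haP
    · by_contra hn
      exact ha (hC a haP hn)
  · change T.base d ∈ P
    rwa [(hF d).1 hd]

/-- Suppose `s`, `t` separate `A` from `B`. Only six corners lie over `s` and `t`, and the cuts
around `A`, `A ∪ {s, t}`, `A ∪ {s}`, `A ∪ {t}` have at least three edges each. Adding these bounds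
forces equality everywhere and no edge `st`; then `s` sends equally many edges to `A` and to `B`,
which is impossible for three edges. -/
theorem contraction_isVertexConnected_three (hT : T.IsSimple)
    (h : G.IsVertexConnected 3) : T.contraction.IsVertexConnected 3 := by
  classical
  have hcard : (4 : ℕ∞) ≤ ENat.card W := by
    obtain ⟨x⟩ : Nonempty W := by
      exact ⟨T.base (h.2 ∅ (by simp)).nonempty.some.1⟩
    have h3 := T.contraction_isCubic hT x
    have h4 : (insert x (T.contraction.neighborSet x)).encard = 4 := by
      rw [Set.encard_insert_of_notMem (by simp), h3]; rfl
    rw [← h4, ← Set.encard_univ]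
    exact Set.encard_le_encard (Set.subset_univ _)
  have two : ∀ (s t x y : W), s ≠ t → ∀ (hx : x ∉ ({s, t} : Finset W))
      (hy : y ∉ ({s, t} : Finset W)),
      (T.contraction.induce {v | v ∉ ({s, t} : Finset W)}).Reachable ⟨x, hx⟩ ⟨y, hy⟩ := by
    intro s t x y hst hx hy
    by_contra hn
    set K := T.contraction.induce {v | v ∉ ({s, t} : Finset W)}
    let A : Set W := {w | ∃ hw, K.Reachable ⟨x, hx⟩ ⟨w, hw⟩}
    let B : Set W := {w | w ∉ A ∧ w ≠ s ∧ w ≠ t}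
    have hxA : x ∈ A := ⟨hx, by rfl⟩
    have hyA : y ∉ A := fun ⟨_, h⟩ => hn h
    have hAst : ∀ w ∈ A, w ≠ s ∧ w ≠ t := by
      rintro w ⟨hw, -⟩; simpa using hw
    have hys : y ≠ s ∧ y ≠ t := by simpa using hy
    have hAB : ∀ d, T.base d ∈ A → T.base (T.mate d) ∉ B := by
      rintro d ⟨hd, hr⟩ ⟨hnA, hb⟩
      refine hnA ⟨by simpa using hb, hr.trans (Adj.reachable ?_)⟩
      exact T.contraction_adj d
    obtain ⟨Fs, hFs3, hFs⟩ := T.exists_finset_fiber s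
    obtain ⟨Ft, hFt3, hFt⟩ := T.exists_finset_fiber t
    have hF3 : ∀ F : Finset V, F.card = 3 → ∀ r : W, (r = s ∨ r = t) →
        (F.filter (fun d => T.base (T.mate d) ∈ A)).card +
        (F.filter (fun d => T.base (T.mate d) ∈ B)).card +
        (F.filter (fun d => T.base (T.mate d) = r)).card ≤ 3 := by
      intro F hF r hr
      rw [← hF, ← Finset.card_union_of_disjoint, ← Finset.card_union_of_disjoint]
      · exact Finset.card_le_card (Finset.union_subset (Finset.union_subset
          (Finset.filter_subset _ _) (Finset.filter_subset _ _)) (Finset.filter_subset _ _))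
      · rw [Finset.disjoint_left]
        intro d hd hd'
        rw [Finset.mem_filter] at hd'
        simp only [Finset.mem_union, Finset.mem_filter, hd'.2] at hd
        rcases hd with hd | hd <;> rcases hr with rfl | rfl
        exacts [(hAst _ hd.2).1 rfl, (hAst _ hd.2).2 rfl, hd.2.2.1 rfl, hd.2.2.2 rfl]
      · rw [Finset.disjoint_left]
        intro d hd hd'
        exact (Finset.mem_filter.1 hd').2.1 (Finset.mem_filter.1 hd).2
    have hs3 := hF3 Fs hFs3 t (.inr rfl)
    have ht3 := hF3 Ft hFt3 s (.inl rfl)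
    set As := Fs.filter (fun d => T.base (T.mate d) ∈ A)
    set At := Ft.filter (fun d => T.base (T.mate d) ∈ A)
    set Bs := Fs.filter (fun d => T.base (T.mate d) ∈ B)
    set Bt := Ft.filter (fun d => T.base (T.mate d) ∈ B)
    set Cs := Fs.filter (fun d => T.base (T.mate d) = t)
    set Ct := Ft.filter (fun d => T.base (T.mate d) = s)
    have mAs : ∀ d, d ∈ As ↔ T.base d = s ∧ T.base (T.mate d) ∈ A := by simp [As, hFs]
    have mAt : ∀ d, d ∈ At ↔ T.base d = t ∧ T.base (T.mate d) ∈ A := by simp [At, hFt]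
    have mBs : ∀ d, d ∈ Bs ↔ T.base d = s ∧ T.base (T.mate d) ∈ B := by simp [Bs, hFs]
    have mBt : ∀ d, d ∈ Bt ↔ T.base d = t ∧ T.base (T.mate d) ∈ B := by simp [Bt, hFt]
    have mCs : ∀ d, d ∈ Cs ↔ T.base d = s ∧ T.base (T.mate d) = t := by simp [Cs, hFs]
    have mCt : ∀ d, d ∈ Ct ↔ T.base d = t ∧ T.base (T.mate d) = s := by simp [Ct, hFt]
    have im : ∀ (F : Finset V) d, d ∈ F.image T.mate ↔ T.mate d ∈ F := by
      intro F d
      rw [Finset.mem_image]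
      constructor
      · rintro ⟨e, he, rfl⟩; rwa [T.mate_mate]
      · intro hd; exact ⟨_, hd, T.mate_mate d⟩
    have ci : ∀ F : Finset V, (F.image T.mate).card = F.card := fun F =>
      Finset.card_image_of_injective _ T.mate_injective
    have cls : ∀ w, w ∈ A ∨ w ∈ B ∨ w = s ∨ w = t := fun w => by
      by_cases hwA : w ∈ A
      · exact .inl hwA
      by_cases hws : w = s
      · tauto
      by_cases hwt : w = t
      · tauto
      exact .inr (.inl ⟨hwA, hws, hwt⟩)
    have sA : s ∉ A := fun h => (hAst s h).1 rfl
    have tA : t ∉ A := fun h => (hAst t h).2 rfl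
    -- A cut is recorded by the corners inside the set, so edges from `s` or `t` into `A` enter
    -- through their mates when that end lies outside.
    have c1 := T.three_le_card_cut h (P := A) hxA hyA (As.image T.mate ∪ At.image T.mate)
      (by
        intro d hd hd'
        rw [Finset.mem_union, im, im, mAs, mAt, T.mate_mate]
        have := cls (T.base (T.mate d)); have := hAB d hd; tauto)
      (by
        intro d hd
        rw [Finset.mem_union, im, im, mAs, mAt, T.mate_mate] at hd
        tauto)
    have c2 := T.three_le_card_cut h (P := A ∪ {s, t}) (x := x) (y := y) (.inl hxA)
      (by simp [hyA, hys]) (Bs ∪ Bt)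
      (by
        intro d hd hd'
        rw [Finset.mem_union, mBs, mBt]
        simp only [Set.mem_union, Set.mem_insert_iff, Set.mem_singleton_iff, not_or] at hd hd'
        have := cls (T.base (T.mate d)); have := hAB d; tauto)
      (by
        intro d hd
        rw [Finset.mem_union, mBs, mBt] at hd
        simp only [Set.mem_union, Set.mem_insert_iff, Set.mem_singleton_iff]
        tauto)
    have c3 := T.three_le_card_cut h (P := A ∪ {s}) (x := x) (y := y) (.inl hxA)
      (by simp [hyA, hys]) (Bs ∪ At.image T.mate ∪ Cs)
      (by
        intro d hd hd'
        rw [Finset.mem_union, Finset.mem_union, im, mBs, mAt, mCs, T.mate_mate]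
        simp only [Set.mem_union, Set.mem_singleton_iff, not_or] at hd hd'
        have := cls (T.base (T.mate d)); have := hAB d; tauto)
      (by
        intro d hd
        rw [Finset.mem_union, Finset.mem_union, im, mBs, mAt, mCs, T.mate_mate] at hd
        simp only [Set.mem_union, Set.mem_singleton_iff]
        tauto)
    have c4 := T.three_le_card_cut h (P := A ∪ {t}) (x := x) (y := y) (.inl hxA)
      (by simp [hyA, hys]) (Bt ∪ As.image T.mate ∪ Ct)
      (by
        intro d hd hd'
        rw [Finset.mem_union, Finset.mem_union, im, mBt, mAs, mCt, T.mate_mate]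
        simp only [Set.mem_union, Set.mem_singleton_iff, not_or] at hd hd'
        have := cls (T.base (T.mate d)); have := hAB d; tauto)
      (by
        intro d hd
        rw [Finset.mem_union, Finset.mem_union, im, mBt, mAs, mCt, T.mate_mate] at hd
        simp only [Set.mem_union, Set.mem_singleton_iff]
        tauto)
    have u1 := Finset.card_union_le (As.image T.mate) (At.image T.mate)
    have u2 := Finset.card_union_le Bs Bt
    have u3 := Finset.card_union_le (Bs ∪ At.image T.mate) Cs
    have u3' := Finset.card_union_le Bs (At.image T.mate)
    have u4 := Finset.card_union_le (Bt ∪ As.image T.mate) Ct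
    have u4' := Finset.card_union_le Bt (As.image T.mate)
    rw [ci] at u1 u3' u4'
    rw [ci] at u1
    omega
  have big : ∀ S : Finset W, S.card < 4 → ∃ w, w ∉ S := by
    intro S hS
    by_contra! hall
    have : ENat.card W ≤ S.card := by
      rw [← Set.encard_univ, ← Set.encard_coe_eq_coe_finsetCard]
      exact Set.encard_le_encard fun x _ => hall x
    have h5 := hcard.trans this
    norm_cast at h5
    omega
  refine ⟨lt_of_lt_of_le (by norm_cast) hcard, fun S hS => (connected_iff _).2 ⟨?_, ?_⟩⟩
  · rintro ⟨x, hx⟩ ⟨y, hy⟩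
    -- With at least four vertices, a smaller `S` extends to a pair that still avoids `x` and `y`.
    obtain ⟨s, t, hst, hsub, hxn, hyn⟩ : ∃ s t, s ≠ t ∧ S ⊆ {s, t} ∧ x ∉ ({s, t} : Finset W) ∧
        y ∉ ({s, t} : Finset W) := by
      have hx' : x ∉ S := hx
      have hy' : y ∉ S := hy
      have h01 : S.card = 0 ∨ S.card = 1 ∨ S.card = 2 := by omega
      have add : ∀ s, ∃ t, t ≠ x ∧ t ≠ y ∧ t ≠ s := fun s => by
        obtain ⟨t, ht⟩ := big {x, y, s} (Finset.card_le_three.trans_lt (by norm_num))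
        simp only [Finset.mem_insert, Finset.mem_singleton, not_or] at ht
        exact ⟨t, ht⟩
      rcases h01 with h0 | h1 | h2
      · obtain rfl := Finset.card_eq_zero.1 h0
        obtain ⟨s, hs⟩ := add x
        obtain ⟨t, ht⟩ := add s
        exact ⟨s, t, ht.2.2.symm, by simp, by simp [hs.1.symm, ht.1.symm],
          by simp [hs.2.1.symm, ht.2.1.symm]⟩
      · obtain ⟨s, rfl⟩ := Finset.card_eq_one.1 h1
        obtain ⟨t, ht⟩ := add s
        simp only [Finset.mem_singleton] at hx' hy'
        exact ⟨s, t, ht.2.2.symm, by simp, by simp [hx', ht.1.symm],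
          by simp [hy', ht.2.1.symm]⟩
      · obtain ⟨s, t, hst, rfl⟩ := Finset.card_eq_two.1 h2
        exact ⟨s, t, hst, subset_rfl, hx', hy'⟩
    have := two s t x y hst hxn hyn
    exact this.map (induceHomOfLE T.contraction
      (show {v | v ∉ ({s, t} : Finset W)} ≤ {v | v ∉ S} from fun w hw hwS => hw (hsub hwS))).toHom
  · obtain ⟨w, hw⟩ := big S (by omega)
    exact ⟨⟨w, hw⟩⟩

theorem nonempty_iso_of_bijective {V' : Type*} {W' : Type*} {G' : SimpleGraph V'}
    (T' : Truncation G' W') (f : V → V') (hf : f.Bijective)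
    (hbase : ∀ u v, T'.base (f u) = T'.base (f v) ↔ T.base u = T.base v)
    (hmate : ∀ u, T'.mate (f u) = f (T.mate u)) : Nonempty (G ≃g G') :=
  ⟨⟨Equiv.ofBijective f hf, fun {u v} => by
    change G'.Adj (f u) (f v) ↔ _
    rw [T.adj_iff, T'.adj_iff, hbase, hmate, hf.1.eq_iff, hf.1.ne_iff]⟩⟩

/-- Two triangles joined by two edges can be left only through their third corners `w` and `z`.
Deleting these two would separate any further vertex, so there are just six vertices, and `w` must
be matched to `z`. -/
theorem nonempty_prism_iso (hT : ¬ T.IsSimple) (h : G.IsVertexConnected 3) :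
    Nonempty (prism ≃g G) := by
  classical
  simp only [IsSimple, not_forall] at hT
  obtain ⟨u, v, huv, hm, hne⟩ := hT
  have third : ∀ u v, u ≠ v → T.base u = T.base v → ∃ w, w ≠ u ∧ w ≠ v ∧ T.base w = T.base u ∧
      ∀ x, T.base x = T.base u → x = u ∨ x = v ∨ x = w := by
    intro u v hne huv
    obtain ⟨a, b, h1, h2, h3, ha, hb, hF⟩ := T.exists_fiber_eq u
    rcases hF v huv.symm with rfl | rfl | rfl
    · exact absurd rfl hne
    · exact ⟨b, h2.symm, h3.symm, hb, hF⟩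
    · exact ⟨a, h1.symm, h3, ha, fun x hx => by have := hF x hx; tauto⟩
  obtain ⟨w, hwu, hwv, hw, hF⟩ := third u v hne huv
  obtain ⟨z, hzu, hzv, hz, hF'⟩ := third _ _ (T.mate_injective.ne hne) hm
  have hbm := T.base_mate u
  have all : ∀ x, x = u ∨ x = v ∨ x = w ∨ x = T.mate u ∨ x = T.mate v ∨ x = z := by
    intro x
    by_contra! hx
    have hS : ({w, z} : Finset V).card < 3 := Finset.card_le_two.trans_lt (by norm_num)
    have huz : u ≠ z := fun h' => hbm (by rw [h']; exact (h' ▸ hz).symm)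
    have hr := (h.2 _ hS).preconnected ⟨u, by simp [hwu.symm, huz]⟩ ⟨x, by simp [hx]⟩
    have := reachable_induce_of_closed
      (P := fun y => T.base y = T.base u ∨ T.base y = T.base (T.mate u)) ?_ hr (.inl rfl)
    · rcases this with h' | h'
      · rcases hF x h' with h' | h' | h'
        exacts [hx.1 h', hx.2.1 h', hx.2.2.1 h']
      · rcases hF' x h' with h' | h' | h'
        exacts [hx.2.2.2.1 h', hx.2.2.2.2.1 h', hx.2.2.2.2.2 h']
    · intro a b ha hb hP hab
      simp only [Finset.mem_insert, Finset.mem_singleton, not_or, Set.mem_ofPred_eq] at ha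
      rcases (T.adj_iff a b).1 hab with ⟨-, hab⟩ | rfl
      · rwa [← hab]
      · rcases hP with hP | hP
        · rcases hF a hP with rfl | rfl | rfl
          exacts [.inr rfl, .inr hm.symm, absurd rfl ha.1]
        · rcases hF' a hP with rfl | rfl | rfl
          · rw [T.mate_mate]; exact .inl rfl
          · rw [T.mate_mate]; exact .inl huv.symm
          · exact absurd rfl ha.2
  have hwz : T.base (T.mate w) = T.base (T.mate u) := by
    rcases all (T.mate w) with h' | h' | h' | h' | h' | h' <;> rw [h']
    · exact absurd (by rw [h', hw]) (T.base_mate w)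
    · exact absurd (by rw [h', hw, huv]) (T.base_mate w)
    · exact absurd (by rw [h']) (T.base_mate w)
    · exact hm.symm
    · exact hz
  let g : Fin 3 → V := ![u, v, w]
  have hg : ∀ j, T.base (g j) = T.base u := by
    intro j; fin_cases j
    exacts [rfl, huv.symm, hw]
  have hg' : ∀ j, T.base (T.mate (g j)) = T.base (T.mate u) := by
    intro j; fin_cases j
    exacts [rfl, hm.symm, hwz]
  have ginj : Function.Injective g := by
    intro i j hij
    fin_cases i <;> fin_cases j <;> simp_all [g, eq_comm]
  have gsurj : ∀ x, T.base x = T.base u → ∃ j, g j = x := by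
    intro x hx
    rcases hF x hx with rfl | rfl | rfl
    exacts [⟨0, rfl⟩, ⟨1, rfl⟩, ⟨2, rfl⟩]
  let f : Fin 2 × Fin 3 → V := fun p => if p.1 = 0 then g p.2 else T.mate (g p.2)
  have f0 : ∀ j, f (0, j) = g j := fun j => rfl
  have f1 : ∀ j, f (1, j) = T.mate (g j) := fun j => rfl
  have hi : ∀ i : Fin 2, i = 0 ∨ i = 1 := by decide
  refine prismTruncation.nonempty_iso_of_bijective T f ⟨?_, ?_⟩ ?_ ?_
  · rintro ⟨i, j⟩ ⟨k, l⟩ hij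
    have hb := congrArg T.base hij
    rcases hi i with rfl | rfl <;> rcases hi k with rfl | rfl <;>
      simp only [f0, f1, hg, hg'] at hij hb
    · rw [ginj hij]
    · exact absurd hb.symm hbm
    · exact absurd hb hbm
    · rw [ginj (T.mate_injective hij)]
  · intro x
    by_cases hx : T.base x = T.base u
    · obtain ⟨j, rfl⟩ := gsurj x hx
      exact ⟨(0, j), rfl⟩
    · have : ∃ j, g j = T.mate x := by
        rcases all x with rfl | rfl | rfl | rfl | rfl | rfl
        · exact absurd rfl hx
        · exact absurd huv.symm hx
        · exact absurd hw hx
        · exact ⟨0, (T.mate_mate u).symm⟩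
        · exact ⟨1, (T.mate_mate v).symm⟩
        · refine ⟨2, ?_⟩
          rcases hF' _ hwz with h' | h' | h'
          · exact absurd (T.mate_injective h') hwu
          · exact absurd (T.mate_injective h') hwv
          · rw [← h', T.mate_mate]; rfl
      obtain ⟨j, hj⟩ := this
      exact ⟨(1, j), by rw [f1, hj, T.mate_mate]⟩
  · rintro ⟨i, j⟩ ⟨k, l⟩
    change _ ↔ i = k
    rcases hi i with rfl | rfl <;> rcases hi k with rfl | rfl <;>
      simp [f0, f1, hg, hg', hbm, hbm.symm]
  · rintro ⟨i, j⟩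
    change _ = f (1 - i, j)
    rcases hi i with rfl | rfl
    · rfl
    · exact T.mate_mate _

end Truncation

/-- Two deleted vertices miss one of the three rungs; every other vertex is adjacent to an end of
it. -/
theorem prism_isVertexConnected_three : prism.IsVertexConnected 3 := by
  classical
  refine ⟨by simp; norm_cast, fun S hS => ?_⟩
  obtain ⟨j, hj⟩ : ∃ j, j ∉ S.image Prod.snd := by
    by_contra! hall
    have h1 := Finset.card_le_card (fun j _ => hall j : (Finset.univ : Finset (Fin 3)) ⊆ _)
    have h2 := Finset.card_image_le (s := S) (f := Prod.snd)
    simp at h1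
    omega
  have hjS : ∀ i, (i, j) ∉ S := fun i h => hj (Finset.mem_image.2 ⟨_, h, rfl⟩)
  have hub : ∀ (p : Fin 2 × Fin 3) (hp : p ∉ S),
      (prism.induce {v | v ∉ S}).Reachable ⟨p, hp⟩ ⟨(0, j), hjS 0⟩ := by
    rintro ⟨i, k⟩ hp
    have h1 : (prism.induce {v | v ∉ S}).Reachable ⟨(i, k), hp⟩ ⟨(i, j), hjS i⟩ := by
      by_cases hk : k = j
      · subst hk; rfl
      · exact Adj.reachable (show prism.Adj _ _ from .inl ⟨by simp [hk], rfl⟩)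
    refine h1.trans ?_
    by_cases hi : i = 0
    · subst hi; rfl
    · exact Adj.reachable (show prism.Adj _ _ from .inr ⟨hi, rfl⟩)
  refine (connected_iff _).2 ⟨?_, ⟨⟨(0, j), hjS 0⟩⟩⟩
  rintro ⟨p, hp⟩ ⟨q, hq⟩
  exact (hub p hp).trans (hub q hq).symm

end Connectivity

/-! ### Root graphs of 3-connected wheel-free line graphs -/

section LineGraph

variable {V : Type u} {W : Type v}

theorem not_isWheelFree_of_embedding {G : SimpleGraph V} {n : ℕ} (hn : 3 ≤ n)
    (φ : cycleGraph n ↪g G) {u : V} (hu : u ∉ Set.range φ) {x y z : V} (hx : x ∈ Set.range φ)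
    (hy : y ∈ Set.range φ) (hz : z ∈ Set.range φ) (hxy : x ≠ y) (hxz : x ≠ z) (hyz : y ≠ z)
    (hux : G.Adj u x) (huy : G.Adj u y) (huz : G.Adj u z) : ¬ G.IsWheelFree := by
  intro hG
  set S := insert u (Set.range φ)
  have hS : ∀ {w}, w ∈ Set.range φ → w ∈ S := fun h => .inr h
  let c : S := ⟨u, .inl rfl⟩
  refine hG S ⟨c, ⟨n, hn, ?_⟩, ?_⟩
  · let f : Fin n → {v : S | v ≠ c} := fun i => ⟨⟨φ i, hS ⟨i, rfl⟩⟩, fun h =>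
      hu ⟨i, congrArg Subtype.val h⟩⟩
    have hf : Function.Bijective f := by
      constructor
      · intro i j hij
        exact φ.injective (congrArg (fun t => t.1.1) hij)
      · rintro ⟨⟨w, hw⟩, hwc⟩
        rcases hw with rfl | ⟨i, rfl⟩
        · exact absurd rfl hwc
        · exact ⟨i, rfl⟩
    exact ⟨(⟨Equiv.ofBijective f hf, fun {a b} => φ.map_adj_iff⟩ : cycleGraph n ≃g _).symm⟩
  · have h3 : ({⟨x, hS hx⟩, ⟨y, hS hy⟩, ⟨z, hS hz⟩} : Set S).encard = 3 :=
      Set.encard_eq_three.2 ⟨_, _, _, by simpa, by simpa, by simpa, rfl⟩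
    rw [← h3]
    refine Set.encard_le_encard ?_
    rintro _ (rfl | rfl | rfl)
    exacts [hux, huy, huz]

theorem IsWheelFree.no_K4 {G : SimpleGraph V} (h : G.IsWheelFree) {a b c d : V}
    (hab : G.Adj a b) (hac : G.Adj a c) (had : G.Adj a d) (hbc : G.Adj b c) (hbd : G.Adj b d)
    (hcd : G.Adj c d) : False := by
  have h1 := hbc.ne; have h2 := hbd.ne; have h3 := hcd.ne
  let φ : cycleGraph 3 ↪g G := ⟨⟨![b, c, d], by
    intro i j; fin_cases i <;> fin_cases j <;> simp_all [eq_comm]⟩, by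
    rw [cycleGraph_three_eq_top]
    intro i j
    change G.Adj (![b, c, d] i) (![b, c, d] j) ↔ _
    fin_cases i <;> fin_cases j <;> simp [hbc, hbd, hcd, hbc.symm, hbd.symm, hcd.symm]⟩
  refine not_isWheelFree_of_embedding le_rfl φ (u := a) ?_ ⟨0, rfl⟩ ⟨1, rfl⟩ ⟨2, rfl⟩
    h1 h2 h3 hab hac had h
  rintro ⟨i, hi⟩
  fin_cases i
  exacts [hab.ne hi.symm, hac.ne hi.symm, had.ne hi.symm]

theorem exists_cycleGraph_embedding_lineGraph {n : ℕ} (hn : 3 ≤ n) :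
    Nonempty (cycleGraph n ↪g (cycleGraph n).lineGraph) := by
  obtain ⟨m, rfl⟩ : ∃ m, n = m + 3 := ⟨n - 3, by omega⟩
  have two : ∀ i : Fin (m + 3), i + 1 + 1 ≠ i := by
    intro i h
    have h1 : (1 + 1 : Fin (m + 3)) = 0 := by rw [← sub_eq_zero.2 h]; abel
    have h2 := congrArg Fin.val h1
    simp only [Fin.val_add, Fin.val_zero, Fin.val_one] at h2
    rw [Nat.mod_eq_of_lt (by omega)] at h2
    omega
  let f : Fin (m + 3) → (cycleGraph (m + 3)).edgeSet := fun i => ⟨s(i, i + 1), by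
    rw [mem_edgeSet, cycleGraph_adj]; simp⟩
  have finj : Function.Injective f := by
    intro i j hij
    rcases Sym2.eq_iff.1 (congrArg Subtype.val hij) with h | ⟨h1, h2⟩
    · exact h.1
    · exact absurd (by rw [← h1, h2]) (two j)
  refine ⟨⟨⟨f, finj⟩, fun {i j} => ?_⟩⟩
  change (cycleGraph (m + 3)).lineGraph.Adj (f i) (f j) ↔ _
  rw [lineGraph_adj_iff_exists, finj.ne_iff, cycleGraph_adj, sub_eq_iff_eq_add, sub_eq_iff_eq_add]
  constructor
  · rintro ⟨hne, v, h1, h2⟩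
    simp only [f, Sym2.mem_iff] at h1 h2
    rcases h1 with rfl | rfl <;> rcases h2 with h2 | h2
    · exact absurd h2 hne
    · exact .inl (h2.trans (add_comm _ _))
    · exact .inr (h2.symm.trans (add_comm _ _))
    · exact absurd (add_right_cancel h2) hne
  · rintro (h | h)
    · refine ⟨?_, i, by simp [f], by simp [f, h, add_comm]⟩
      rintro rfl
      simp at h
    · refine ⟨?_, j, by simp [f, h, add_comm], by simp [f]⟩
      rintro rfl
      simp at h

/-- The edges of a cycle form an induced cycle of the line graph. -/
theorem Walk.IsCycle.exists_embedding_lineGraph {R : SimpleGraph W} {x : W} {c : R.Walk x x}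
    (hc : c.IsCycle) : ∃ φ : cycleGraph c.length ↪g R.lineGraph,
      ∀ e : R.edgeSet, e ∈ Set.range φ ↔ (e : Sym2 W) ∈ c.edges := by
  classical
  -- Working in the subgraph `C` of the edges of the cycle pins down the range: `C` has at most
  -- `c.length` edges, so an embedding of the cycle into its line graph is onto.
  set C : SimpleGraph W := fromEdgeSet {e | e ∈ c.edges}
  have hCe : C.edgeSet = {e | e ∈ c.edges} := by
    rw [edgeSet_fromEdgeSet, sdiff_eq_left, Set.disjoint_left]
    intro e he hd
    exact R.not_isDiag_of_mem_edgeSet (c.edges_subset_edgeSet he) hd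
  have hle : C ≤ R := by
    rw [← edgeSet_subset_edgeSet, hCe]
    exact fun e he => c.edges_subset_edgeSet he
  have hcC : ∀ e ∈ c.edges, e ∈ C.edgeSet := fun e he => by rw [hCe]; exact he
  obtain ⟨f⟩ : cycleGraph c.length ⊑ C := by
    rw [cycleGraph_isContained_iff hc.three_le_length]
    exact ⟨x, c.transfer C hcC, hc.transfer hcC, by simp⟩
  obtain ⟨g⟩ := exists_cycleGraph_embedding_lineGraph hc.three_le_length
  let ψ : cycleGraph c.length ↪g C.lineGraph := f.toLineGraphEmbedding.comp g
  have hfin : Finite C.edgeSet := by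
    rw [hCe]; exact List.finite_toSet c.edges
  have hcard : Nat.card C.edgeSet ≤ Nat.card (Fin c.length) := by
    rw [hCe, Nat.card_fin, ← c.length_edges]
    have : {e | e ∈ c.edges} = (c.edges.toFinset : Set (Sym2 W)) := by ext; simp
    rw [this, Nat.card_coe_set_eq, Set.ncard_coe_finset]
    exact List.toFinset_card_le _
  have hsurj := (ψ.injective.bijective_of_nat_card_le hcard).2
  let ι : C.lineGraph ↪g R.lineGraph := (Copy.ofLE C R hle).toLineGraphEmbedding
  have hι : ∀ e, (ι e : Sym2 W) = e := fun e => by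
    change Sym2.map _ _ = _
    exact Sym2.map_id' ▸ rfl
  refine ⟨ι.comp ψ, fun e => ⟨?_, fun he => ?_⟩⟩
  · rintro ⟨i, rfl⟩
    change (ι (ψ i) : Sym2 W) ∈ c.edges
    rw [hι]
    exact hCe.subset (ψ i).2
  · obtain ⟨i, hi⟩ := hsurj ⟨e, hcC e he⟩
    refine ⟨i, Subtype.ext ?_⟩
    change (ι (ψ i) : Sym2 W) = _
    rw [hι, hi]

/-- Moves the common end of two edge-disjoint paths from `z'` to its neighbor `z`. The walk `S`
avoids the edge `zz'` and first meets the two paths in `w`; the path through `w` is rerouted there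
along `S` back to `z`, and the other one is prolonged by `z'z`. -/
theorem exists_disjoint_walks_step [DecidableEq W] {R : SimpleGraph W} {x z z' : W}
    (hzz : R.Adj z z') {P Q : R.Walk x z'} (hP : P.IsPath) (hPQ : P.edges.Disjoint Q.edges)
    {S : R.Walk z x} (hS : s(z, z') ∉ S.edges) {w : W} (hwS : w ∈ S.support)
    (hw : ∀ t, t ∈ P.support ∨ t ∈ Q.support → t ∈ (S.takeUntil w hwS).support → t = w)
    (hwP : w ∈ P.support) :
    ∃ P' Q' : R.Walk x z, P'.IsPath ∧ Q'.IsPath ∧ P'.edges.Disjoint Q'.edges := by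
  set P₁ := (P.takeUntil w hwP).append (S.takeUntil w hwS).reverse
  set Q₁ := Q.concat hzz.symm
  have key : P₁.edges.Disjoint Q₁.edges := by
    intro e he he'
    simp only [P₁, Q₁, Walk.edges_append, Walk.edges_reverse, List.mem_append, List.mem_reverse,
      Walk.edges_concat, List.concat_eq_append, List.mem_singleton] at he he'
    rcases he with he | he <;> rcases he' with he' | rfl
    · exact hPQ (P.edges_takeUntil_subset_edges hwP he) he'
    · have h1 := Walk.snd_mem_support_of_mem_edges _ he
      have h2 := Walk.fst_mem_support_of_mem_edges _ he
      have hzw : z = w := hw z (.inl (P.support_takeUntil_subset_support hwP h1))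
        (Walk.start_mem_support _)
      exact Walk.endpoint_notMem_support_takeUntil hP hwP
        (fun h => hzz.ne (hzw.trans h.symm)) h2
    · induction e using Sym2.ind with
      | _ a b =>
        have ha := hw a (.inr (Walk.fst_mem_support_of_mem_edges _ he'))
          (Walk.fst_mem_support_of_mem_edges _ he)
        have hb := hw b (.inr (Walk.snd_mem_support_of_mem_edges _ he'))
          (Walk.snd_mem_support_of_mem_edges _ he)
        exact (Q.adj_of_mem_edges he').ne (ha.trans hb.symm)
    · exact hS (S.edges_takeUntil_subset_edges hwS (Sym2.eq_swap ▸ he))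
  exact ⟨P₁.bypass, Q₁.bypass, P₁.bypass_isPath, Q₁.bypass_isPath, fun e he he' =>
    key (P₁.edges_bypass_subset_edges he) (Q₁.edges_bypass_subset_edges he')⟩

/-- Two vertices that no edge separates are joined by two edge-disjoint paths. -/
theorem IsEdgeReachable.exists_disjoint_paths {R : SimpleGraph W} {x y : W}
    (h : R.IsEdgeReachable 2 x y) :
    ∃ P Q : R.Walk x y, P.IsPath ∧ Q.IsPath ∧ P.edges.Disjoint Q.edges := by
  classical
  obtain ⟨p, hp⟩ := (h.symm.reachable (by simp)).exists_isPath
  -- Strengthened for the induction along `p`, since each step needs a detour around the edge it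
  -- crosses.
  have hall : ∀ z ∈ p.support, R.IsEdgeReachable 2 z x := fun z hz =>
    hp.isTrail.isEdgeReachable_two_of_isEdgeReachable_two h.symm hz p.end_mem_support
  clear hp h
  induction p with
  | nil => exact ⟨.nil, .nil, by simp, by simp, by simp⟩
  | @cons z z' x hzz p ih =>
    obtain ⟨P, Q, hP, hQ, hPQ⟩ := ih fun w hw => hall w (by simp [hw])
    obtain ⟨S₀⟩ := isEdgeReachable_two.1 (hall z (by simp)) s(z, z')
    set S := S₀.mapLe (deleteEdges_le {s(z, z')})
    have hS : s(z, z') ∉ S.edges := by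
      intro he
      simp only [S, Walk.edges_mapLe_eq_edges] at he
      have := S₀.adj_of_mem_edges he
      simp [deleteEdges_adj] at this
    obtain ⟨w, hws, hwS, hw⟩ := S.exists_mem_support_forall_mem_support_imp_eq
      (P.support.toFinset ∪ Q.support.toFinset) ⟨x, by simp⟩
    simp only [Finset.mem_union, List.mem_toFinset] at hws hw
    rcases hws with hwP | hwQ
    · exact exists_disjoint_walks_step hzz hP hPQ hS hwS hw hwP
    · exact exists_disjoint_walks_step hzz hQ hPQ.symm hS hwS (fun t ht => hw t ht.symm) hwQ

theorem Walk.IsPath.exists_two_edges {R : SimpleGraph W} {x y w : W} {p : R.Walk x y}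
    (hp : p.IsPath) (hw : w ∈ p.support) (hwx : w ≠ x) (hwy : w ≠ y) :
    ∃ a b, a ≠ b ∧ s(w, a) ∈ p.edges ∧ s(w, b) ∈ p.edges := by
  obtain ⟨i, rfl, hi⟩ := Walk.mem_support_iff_exists_getVert.1 hw
  have h0 : i ≠ 0 := by rintro rfl; simp at hwx
  have hl : i < p.length := lt_of_le_of_ne hi (by rintro rfl; simp at hwy)
  have h1 := hp.neighborSet_toSubgraph_internal h0 hl
  have h2 := hp.ncard_neighborSet_toSubgraph_internal_eq_two h0 hl
  obtain ⟨a, b, hab, h⟩ := Set.ncard_eq_two.1 h2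
  have ha : a ∈ p.toSubgraph.neighborSet (p.getVert i) := by rw [h]; simp
  have hb : b ∈ p.toSubgraph.neighborSet (p.getVert i) := by rw [h]; simp
  refine ⟨a, b, hab, ?_, ?_⟩
  · rwa [← Walk.mem_edges_toSubgraph, Subgraph.mem_edgeSet]
  · rwa [← Walk.mem_edges_toSubgraph, Subgraph.mem_edgeSet]

section Root

variable {R : SimpleGraph W}

theorem lineGraph_adj_of_mem {e f : R.edgeSet} (hne : (e : Sym2 W) ≠ f) (x : W)
    (he : x ∈ (e : Sym2 W)) (hf : x ∈ (f : Sym2 W)) : R.lineGraph.Adj e f :=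
  lineGraph_adj_iff_exists.2 ⟨fun h => hne (congrArg Subtype.val h), x, he, hf⟩

theorem exists_of_lineGraph_adj {x y : W} (h : R.Adj x y) {e : R.edgeSet}
    (he : R.lineGraph.Adj ⟨s(x, y), h⟩ e) :
    (∃ a, a ≠ y ∧ ∃ ha : R.Adj x a, e = ⟨s(x, a), ha⟩) ∨
      (∃ a, a ≠ x ∧ ∃ ha : R.Adj y a, e = ⟨s(y, a), ha⟩) := by
  obtain ⟨hne, v, hv, hve⟩ := lineGraph_adj_iff_exists.1 he
  obtain ⟨e, he'⟩ := e
  obtain ⟨w, rfl⟩ := Sym2.mem_iff_exists.1 hve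
  rcases Sym2.mem_iff.1 hv with rfl | rfl
  · exact .inl ⟨w, fun h' => hne (by subst h'; rfl), he', rfl⟩
  · exact .inr ⟨w, fun h' => hne (by subst h'; exact Subtype.ext Sym2.eq_swap), he', rfl⟩

theorem IsWheelFree.root_degree_le (hR : R.lineGraph.IsWheelFree) {x a b c d : W}
    (ha : R.Adj x a) (hb : R.Adj x b) (hc : R.Adj x c) (hd : R.Adj x d) (hab : a ≠ b)
    (hac : a ≠ c) (had : a ≠ d) (hbc : b ≠ c) (hbd : b ≠ d) (hcd : c ≠ d) : False := by
  have key : ∀ {a b} (ha : R.Adj x a) (hb : R.Adj x b), a ≠ b →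
      R.lineGraph.Adj ⟨s(x, a), ha⟩ ⟨s(x, b), hb⟩ := fun ha hb hab =>
    lineGraph_adj_of_mem (fun h => hab (Sym2.congr_right.1 h)) x (by simp) (by simp)
  exact hR.no_K4 (key ha hb hab) (key ha hc hac) (key ha hd had) (key hb hc hbc) (key hb hd hbd)
    (key hc hd hcd)

/-- If the line graph of `R` is 3-connected, then the ends of an edge `xy` with further neighbors
`a`, `b` of `x` and `c`, `d` of `y` remain 2-edge-connected after deleting the edge. -/
theorem isEdgeReachable_two_deleteEdges (hR : R.lineGraph.IsVertexConnected 3) {x y a b c d : W}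
    (ha : R.Adj x a) (hb : R.Adj x b) (hab : a ≠ b) (hay : a ≠ y)
    (hby : b ≠ y) (hc : R.Adj y c) (hd : R.Adj y d) (hcd : c ≠ d) (hcx : c ≠ x) (hdx : d ≠ x) :
    (R.deleteEdges {s(x, y)}).IsEdgeReachable 2 x y := by
  classical
  rw [isEdgeReachable_two]
  intro f
  -- Deleting the edges `xy` and `f` of `R` deletes at most two vertices of the line graph; `f` need
  -- not be an edge.
  have hex : ∃ S : Finset R.edgeSet, S.card < 3 ∧ ∀ g, g ∈ S ↔ (g : Sym2 W) = s(x, y) ∨ g = f := by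
    refine ⟨({s(x, y), f} : Finset (Sym2 W)).subtype (· ∈ R.edgeSet), ?_, by simp⟩
    rw [Finset.card_subtype]
    exact ((Finset.card_filter_le _ _).trans Finset.card_le_two).trans_lt (by norm_num)
  obtain ⟨S, hS3, hS⟩ := hex
  have alive : ∀ {x y a b : W}, R.Adj x a → R.Adj x b → a ≠ b → a ≠ y → b ≠ y →
      ∃ a, R.Adj x a ∧ s(x, a) ≠ s(x, y) ∧ s(x, a) ≠ f := by
    intro x y a b ha hb hab hay hby
    by_cases h : s(x, a) = f
    · refine ⟨b, hb, fun h' => hby (Sym2.congr_right.1 h'), fun h' => hab ?_⟩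
      exact Sym2.congr_right.1 (h.trans h'.symm)
    · exact ⟨a, ha, fun h' => hay (Sym2.congr_right.1 h'), h⟩
  obtain ⟨g, hg, hgxy, hgf⟩ := alive ha hb hab hay hby
  obtain ⟨k, hk, hkxy, hkf⟩ := alive hc hd hcd hcx hdx
  rw [Sym2.eq_swap (a := y) (b := x)] at hkxy
  have hr := (hR.2 S hS3).preconnected ⟨⟨s(x, g), hg⟩, by simp [hS, hgxy, hgf]⟩
    ⟨⟨s(y, k), hk⟩, by simp only [Set.mem_ofPred_eq, hS]; tauto⟩
  have step : ∀ {e : Sym2 W}, e ∈ R.edgeSet → e ≠ s(x, y) → e ≠ f → ∀ u ∈ e, ∀ v ∈ e,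
      ((R.deleteEdges {s(x, y)}).deleteEdges {f}).Reachable u v := by
    intro e he h1 h2 u hu v hv
    by_cases huv : u = v
    · subst huv; rfl
    · obtain rfl := (Sym2.mem_and_mem_iff huv).1 ⟨hu, hv⟩
      exact Adj.reachable (by simpa [deleteEdges_adj, h2] using ⟨he, by simpa using h1⟩)
  refine reachable_induce_of_closed (P := fun e : R.edgeSet => ∀ v ∈ (e : Sym2 W),
    ((R.deleteEdges {s(x, y)}).deleteEdges {f}).Reachable x v) ?_ hr ?_ y (by simp)
  · intro e e' he he' ih hadj v hv
    obtain ⟨-, w, hw, hw'⟩ := lineGraph_adj_iff_exists.1 hadj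
    simp only [Set.mem_ofPred_eq, hS, not_or] at he'
    exact (ih w hw).trans (step e'.2 he'.1 he'.2 w hw' v hv)
  · exact step hg hgxy hgf x (by simp)

/-- In a root graph of a 3-connected wheel-free line graph, no edge has two further edges at both
of its ends. -/
theorem IsWheelFree.root_edge (hR : R.lineGraph.IsVertexConnected 3)
    (hw : R.lineGraph.IsWheelFree) {x y a b c d : W} (hxy : R.Adj x y)
    (ha : R.Adj x a) (hb : R.Adj x b) (hab : a ≠ b) (hay : a ≠ y)
    (hby : b ≠ y) (hc : R.Adj y c) (hd : R.Adj y d) (hcd : c ≠ d) (hcx : c ≠ x) (hdx : d ≠ x) :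
    False := by
  set R' := R.deleteEdges {s(x, y)}
  obtain ⟨P, Q, hP, hQ, hPQ⟩ := (isEdgeReachable_two_deleteEdges hR ha hb hab hay hby hc hd hcd
    hcx hdx).exists_disjoint_paths
  have hne := hxy.ne
  have hle : R' ≤ R := deleteEdges_le _
  -- Edge-disjoint paths sharing an inner vertex would give it degree four.
  have common : ∀ w, w ∈ P.support → w ∈ Q.support → w = x ∨ w = y := by
    intro w hwP hwQ
    by_contra! hn
    obtain ⟨a, b, hab, ha, hb⟩ := hP.exists_two_edges hwP hn.1 hn.2
    obtain ⟨c, d, hcd, hc, hd⟩ := hQ.exists_two_edges hwQ hn.1 hn.2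
    have aux : ∀ {s t}, s(w, s) ∈ P.edges → s(w, t) ∈ Q.edges → s ≠ t := fun hs ht h =>
      hPQ hs (h ▸ ht)
    exact hw.root_degree_le (hle (P.adj_of_mem_edges ha)) (hle (P.adj_of_mem_edges hb))
      (hle (Q.adj_of_mem_edges hc)) (hle (Q.adj_of_mem_edges hd)) hab (aux ha hc) (aux ha hd)
      (aux hb hc) (aux hb hd) hcd
  have hPn : ¬ P.Nil := Walk.not_nil_of_ne hne
  have hQn : ¬ Q.Nil := Walk.not_nil_of_ne hne
  have hlen : 1 < P.length := by
    by_contra! hl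
    have h0 := Walk.not_nil_iff_lt_length.1 hPn
    have := Walk.adj_of_length_eq_one (show P.length = 1 by omega)
    simp [deleteEdges_adj] at this
  have hcyc : (P.append Q.reverse).IsCycle := by
    refine hP.isCycle_append hQ.reverse ?_ (.inl hlen)
    intro w h1 h2
    have hx : x ∉ P.support.tail := by
      have := hP.support_nodup
      rw [← Walk.cons_tail_support] at this
      exact (List.nodup_cons.1 this).1
    have hy : y ∉ Q.reverse.support.tail := by
      have := hQ.reverse.support_nodup
      rw [← Walk.cons_tail_support] at this
      exact (List.nodup_cons.1 this).1
    rcases common w (List.mem_of_mem_tail h1)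
      (by simpa using List.mem_of_mem_tail h2) with rfl | rfl
    exacts [hx h1, hy h2]
  obtain ⟨φ, hφ⟩ := (hcyc.mapLe hle).exists_embedding_lineGraph
  have hφ' : ∀ e : R.edgeSet, e ∈ Set.range φ ↔ (e : Sym2 W) ∈ P.edges ∨ (e : Sym2 W) ∈ Q.edges := by
    intro e
    rw [hφ, Walk.edges_mapLe_eq_edges]
    simp
  have hmem : ∀ {e}, e ∈ R'.edgeSet → e ∈ R.edgeSet ∧ e ≠ s(x, y) := by
    intro e he
    simpa [R', edgeSet_deleteEdges] using he
  -- The hub of the wheel is `xy`; its three rim neighbors are the first edges of `P` and `Q` and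
  -- the last edge of `P`.
  have hp1 : s(x, P.snd) ∈ P.edges := P.mk_start_snd_mem_edges hPn
  have hq1 : s(x, Q.snd) ∈ Q.edges := Q.mk_start_snd_mem_edges hQn
  have hp2 : s(P.penultimate, y) ∈ P.edges := P.mk_penultimate_end_mem_edges hPn
  have mp1 := hmem (P.edges_subset_edgeSet hp1)
  have mq1 := hmem (Q.edges_subset_edgeSet hq1)
  have mp2 := hmem (P.edges_subset_edgeSet hp2)
  have xy : ∀ {e : Sym2 W}, x ∈ e → y ∈ e → e = s(x, y) := fun h1 h2 =>
    (Sym2.mem_and_mem_iff hne).1 ⟨h1, h2⟩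
  refine not_isWheelFree_of_embedding (hcyc.mapLe hle).three_le_length φ (u := ⟨s(x, y), hxy⟩)
    (x := ⟨_, mp1.1⟩) (y := ⟨_, mq1.1⟩) (z := ⟨_, mp2.1⟩) ?_ ((hφ' _).2 (.inl hp1))
    ((hφ' _).2 (.inr hq1)) ((hφ' _).2 (.inl hp2)) ?_ ?_ ?_ ?_ ?_ ?_ hw
  · rw [hφ']
    rintro (h | h)
    · exact (hmem (P.edges_subset_edgeSet h)).2 rfl
    · exact (hmem (Q.edges_subset_edgeSet h)).2 rfl
  · intro h
    have h' : s(x, P.snd) = s(x, Q.snd) := congrArg Subtype.val h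
    exact hPQ hp1 (h' ▸ hq1)
  · intro h
    have h' : s(x, P.snd) = s(P.penultimate, y) := congrArg Subtype.val h
    exact mp1.2 (xy (by simp) (by rw [h']; simp))
  · intro h
    have h' : s(x, Q.snd) = s(P.penultimate, y) := congrArg Subtype.val h
    exact mq1.2 (xy (by simp) (by rw [h']; simp))
  · exact lineGraph_adj_of_mem mp1.2.symm x (by simp) (by simp)
  · exact lineGraph_adj_of_mem mq1.2.symm x (by simp) (by simp)
  · exact lineGraph_adj_of_mem mp2.2.symm y (by simp) (by simp)

/-- An edge of the root graph has at least three adjacent edges, at most two at each end by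
`root_degree_le`, and not two at both ends by `root_edge`. So there are two at one end, which are
adjacent, and one at the other, which is isolated unless it closes a triangle. -/
theorem IsWheelFree.isLocallyTriangular_lineGraph (hR : R.lineGraph.IsVertexConnected 3)
    (hw : R.lineGraph.IsWheelFree) : R.lineGraph.IsLocallyTriangular := by
  classical
  have fin : ∀ {x y a b c : W} (hxy : R.Adj x y) (ha : R.Adj x a) (hb : R.Adj x b)
      (hc : R.Adj y c), a ≠ b → a ≠ y → b ≠ y → c ≠ x →
      ∃ p q r, R.lineGraph.neighborSet ⟨s(x, y), hxy⟩ = {p, q, r} ∧ R.lineGraph.Adj p q ∧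
        ¬ R.lineGraph.Adj p r ∧ ¬ R.lineGraph.Adj q r := by
    intro x y a b c hxy ha hb hc hab hay hby hcx
    -- `c` is the only neighbor of `y` other than `x`
    have hy : ∀ d, R.Adj y d → d = x ∨ d = c := by
      intro d hd
      by_contra! hn
      exact hw.root_edge hR hxy ha hb hab hay hby hc hd hn.2.symm hcx hn.1
    -- In a triangle `x y a`, the edge `ya` needs a third adjacent edge, which can only be at `a`;
    -- then `xa` has two further edges at both ends.
    have tri : ∀ {a b : W}, R.Adj x a → R.Adj x b → a ≠ b → a ≠ y → b ≠ y → a ≠ c := by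
      rintro a b ha hb hab hay hby rfl
      obtain ⟨e, he, heS⟩ := hR.exists_adj_notMem ⟨s(y, a), hc⟩
        {⟨s(x, y), hxy⟩, ⟨s(x, a), ha⟩} (Finset.card_le_two.trans_lt (by norm_num))
      simp only [Finset.mem_insert, Finset.mem_singleton, not_or] at heS
      rcases exists_of_lineGraph_adj hc he with ⟨d, hda, hd, rfl⟩ | ⟨d, hdy, hd, rfl⟩
      · rcases hy d hd with rfl | rfl
        · exact heS.1 (Subtype.ext Sym2.eq_swap)
        · exact hda rfl
      · have hdx : d ≠ x := by rintro rfl; exact heS.2 (Subtype.ext Sym2.eq_swap)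
        exact hw.root_edge hR ha hxy hb hby.symm hay.symm hab.symm hc.symm hd hdy.symm hxy.ne'
          hdx
    have hac := tri ha hb hab hay hby
    have hbc := tri hb ha hab.symm hby hay
    have far : ∀ {a : W} (ha : R.Adj x a), a ≠ y → a ≠ c →
        ¬ R.lineGraph.Adj ⟨s(x, a), ha⟩ ⟨s(y, c), hc⟩ := by
      intro a ha hay hac h
      obtain ⟨-, v, h1, h2⟩ := lineGraph_adj_iff_exists.1 h
      rcases Sym2.mem_iff.1 h1 with rfl | rfl <;> rcases Sym2.mem_iff.1 h2 with h | h
      exacts [hxy.ne h, hcx h.symm, hay h, hac h]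
    refine ⟨⟨s(x, a), ha⟩, ⟨s(x, b), hb⟩, ⟨s(y, c), hc⟩, ?_, ?_, far ha hay hac, far hb hby hbc⟩
    · ext e
      simp only [mem_neighborSet, Set.mem_insert_iff, Set.mem_singleton_iff]
      constructor
      · intro he
        rcases exists_of_lineGraph_adj hxy he with ⟨d, hdy, hd, rfl⟩ | ⟨d, hdx, hd, rfl⟩
        · by_cases hda : d = a
          · subst hda; exact .inl rfl
          by_cases hdb : d = b
          · subst hdb; exact .inr (.inl rfl)
          exact (hw.root_degree_le hxy ha hb hd hay.symm hby.symm hdy.symm hab (Ne.symm hda)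
            (Ne.symm hdb)).elim
        · rcases hy d hd with rfl | rfl
          · exact absurd rfl hdx
          · exact .inr (.inr rfl)
      · rintro (rfl | rfl | rfl)
        · exact lineGraph_adj_of_mem (fun h => hay (Sym2.congr_right.1 h).symm) x (by simp)
            (by simp)
        · exact lineGraph_adj_of_mem (fun h => hby (Sym2.congr_right.1 h).symm) x (by simp)
            (by simp)
        · refine lineGraph_adj_of_mem (fun h => hcx ?_) y (by simp) (by simp)
          exact (Sym2.congr_right.1 (Sym2.eq_swap.trans h)).symm
    · exact lineGraph_adj_of_mem (fun h => hab (Sym2.congr_right.1 h)) x (by simp) (by simp)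
  rintro ⟨e, he⟩
  induction e using Sym2.ind with
  | _ x y =>
    have hxy : R.Adj x y := he
    have swap : (⟨s(x, y), he⟩ : R.edgeSet) = ⟨s(y, x), hxy.symm⟩ := Subtype.ext Sym2.eq_swap
    obtain ⟨e₁, h₁, -⟩ := hR.exists_adj_notMem ⟨s(x, y), he⟩ ∅ (by simp)
    obtain ⟨e₂, h₂, h₂S⟩ := hR.exists_adj_notMem ⟨s(x, y), he⟩ {e₁} (by simp)
    obtain ⟨e₃, h₃, h₃S⟩ := hR.exists_adj_notMem ⟨s(x, y), he⟩ {e₁, e₂}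
      (Finset.card_le_two.trans_lt (by norm_num))
    simp only [Finset.mem_insert, Finset.mem_singleton, not_or] at h₂S h₃S
    have ne : ∀ {x a b : W} {ha : R.Adj x a} {hb : R.Adj x b},
        (⟨s(x, a), ha⟩ : R.edgeSet) ≠ ⟨s(x, b), hb⟩ → a ≠ b := by
      rintro x a b ha hb h rfl; exact h rfl
    have three : ∀ {x y a b c : W}, R.Adj x y → R.Adj x a → R.Adj x b → R.Adj x c → a ≠ y →
        b ≠ y → c ≠ y → b ≠ a → c ≠ a → c ≠ b → False :=
      fun hy ha hb hc h1 h2 h3 h4 h5 h6 => hw.root_degree_le hy ha hb hc h1.symm h2.symm h3.symm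
        h4.symm h5.symm h6.symm
    -- Each of the three adjacent edges is at `x` or at `y`: three at one end is degree four, and a
    -- split into two and one is `fin` up to swapping the ends.
    rcases exists_of_lineGraph_adj hxy h₁ with ⟨a, hay, ha, rfl⟩ | ⟨a, hay, ha, rfl⟩ <;>
    rcases exists_of_lineGraph_adj hxy h₂ with ⟨b, hby, hb, rfl⟩ | ⟨b, hby, hb, rfl⟩ <;>
    rcases exists_of_lineGraph_adj hxy h₃ with ⟨c, hcy, hc, rfl⟩ | ⟨c, hcy, hc, rfl⟩
    · exact (three hxy ha hb hc hay hby hcy (ne h₂S) (ne h₃S.1) (ne h₃S.2)).elim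
    · exact fin hxy ha hb hc (ne h₂S).symm hay hby hcy
    · exact fin hxy ha hc hb (ne h₃S.1).symm hay hcy hby
    · rw [swap]; exact fin hxy.symm hb hc ha (ne h₃S.2).symm hby hcy hay
    · exact fin hxy hb hc ha (ne h₃S.2).symm hby hcy hay
    · rw [swap]; exact fin hxy.symm ha hc hb (ne h₃S.1).symm hay hcy hby
    · rw [swap]; exact fin hxy.symm ha hb hc (ne h₂S).symm hay hby hcy
    · exact (three hxy.symm ha hb hc hay hby hcy (ne h₂S) (ne h₃S.1) (ne h₃S.2)).elim

end Root

end LineGraph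

/-! ### Arcs and chords in the plane -/

section Arcs

theorem IsPlanar.of_iso {V : Type u} {V' : Type v} {G : SimpleGraph V} {G' : SimpleGraph V'}
    (h : G.IsPlanar) (e : G ≃g G') : G'.IsPlanar := by
  obtain ⟨D⟩ := h
  have hadj : ∀ f ∈ G'.edgeSet, f.map e.symm ∈ G.edgeSet := by
    intro f hf
    induction f using Sym2.ind with
    | _ x y => exact e.symm.map_adj_iff.2 hf
  refine ⟨⟨fun v => D.point (e.symm v), fun f => D.arc (f.map e.symm),
    D.point_injective.comp e.symm.injective, fun v w h => ?_, fun f hf v hv => ?_,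
    fun f hf g hg hfg p hp => ?_⟩⟩
  · exact D.isArc _ _ (e.symm.map_adj_iff.2 h)
  · obtain ⟨w, hw, hwv⟩ := Sym2.mem_map.1 (D.mem_of_point_mem _ (hadj f hf) _ hv)
    rwa [← e.symm.injective hwv]
  · obtain ⟨v, h1, h2, h3⟩ := D.arc_inter _ (hadj f hf) _ (hadj g hg)
      ((Sym2.map.injective e.symm.injective).ne hfg) p hp
    obtain ⟨w, hw, rfl⟩ := Sym2.mem_map.1 h1
    obtain ⟨w', hw', hww⟩ := Sym2.mem_map.1 h2
    rw [e.symm.injective hww] at hw'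
    exact ⟨w, hw, hw', h3⟩

theorem IsArcBetween.symm {x y : EuclideanSpace ℝ (Fin 2)} {A : Set (EuclideanSpace ℝ (Fin 2))}
    (h : IsArcBetween x y A) : IsArcBetween y x A := by
  obtain ⟨γ, hγ, rfl⟩ := h
  exact ⟨γ.symm, hγ.comp unitInterval.symm_bijective.1, by simp⟩

theorem IsArcBetween.trans {x y z : EuclideanSpace ℝ (Fin 2)}
    {A B : Set (EuclideanSpace ℝ (Fin 2))} (hA : IsArcBetween x y A) (hB : IsArcBetween y z B)
    (hAB : ∀ p ∈ A, p ∈ B → p = y) : IsArcBetween x z (A ∪ B) := by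
  obtain ⟨γ, hγ, rfl⟩ := hA
  obtain ⟨δ, hδ, rfl⟩ := hB
  refine ⟨γ.trans δ, ?_, Path.trans_range γ δ⟩
  have mix : ∀ (s t : unitInterval), γ s = δ t → (s : ℝ) = 1 ∧ (t : ℝ) = 0 := by
    intro s t h
    have h1 := hAB (γ s) ⟨s, rfl⟩ ⟨t, h.symm⟩
    have h2 : s = 1 := hγ (h1.trans γ.target.symm)
    have h3 : t = 0 := hδ ((h.symm.trans h1).trans δ.source.symm)
    simp [h2, h3]
  intro s t hst
  rw [Path.trans_apply, Path.trans_apply] at hst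
  split_ifs at hst with h1 h2 h2
  · have := congrArg Subtype.val (hγ hst)
    apply Subtype.ext
    simpa using this
  · have := mix _ _ hst
    simp only at this
    linarith [this.1, this.2]
  · have := mix _ _ hst.symm
    simp only at this
    linarith [this.1, this.2]
  · have := congrArg Subtype.val (hδ hst)
    apply Subtype.ext
    simpa using this

theorem isArcBetween_segment {x y : EuclideanSpace ℝ (Fin 2)} (h : x ≠ y) :
    IsArcBetween x y (segment ℝ x y) := by
  refine ⟨⟨⟨fun t => AffineMap.lineMap x y (t : ℝ), by
    simp only [AffineMap.lineMap_apply]; fun_prop⟩, by simp, by simp⟩, ?_, ?_⟩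
  · intro s t hst
    exact Subtype.ext (AffineMap.lineMap_injective ℝ h hst)
  · rw [segment_eq_image_lineMap]
    ext z
    constructor
    · rintro ⟨t, rfl⟩; exact ⟨t, t.2, rfl⟩
    · rintro ⟨t, ht, rfl⟩; exact ⟨⟨t, ht⟩, rfl⟩

theorem isArcBetween_image_Icc {γ : unitInterval → EuclideanSpace ℝ (Fin 2)} (hc : Continuous γ)
    (hi : Function.Injective γ) {s t : unitInterval} (hst : s < t) :
    IsArcBetween (γ s) (γ t) (γ '' Set.Icc s t) := by
  let p : _root_.Path (γ 0) (γ 1) := ⟨⟨γ, hc⟩, rfl, rfl⟩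
  refine ⟨p.subpath s t, ?_, p.range_subpath_of_le s t hst.le⟩
  intro a b hab
  have h1 : Set.Icc.convexComb s t a = Set.Icc.convexComb s t b := hi hab
  have h2 := congrArg Subtype.val h1
  rw [Set.Icc.coe_convexComb, Set.Icc.coe_convexComb] at h2
  have h3 : (s : ℝ) < t := hst
  apply Subtype.ext
  have h4 : ((a : ℝ) - b) * (t - s) = 0 := by linear_combination h2
  rcases mul_eq_zero.1 h4 with h | h <;> linarith

/-- A chord of a circle meets the circle only in its ends. -/
theorem eq_or_eq_of_mem_segment_of_dist_eq {c x y z : EuclideanSpace ℝ (Fin 2)} {r : ℝ}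
    (hx : Dist.dist x c = r) (hy : Dist.dist y c = r) (hz : Dist.dist z c = r) (h : z ∈ segment ℝ x y) :
    z = x ∨ z = y := by
  by_cases hxy : x = y
  · subst hxy; simpa using h
  rw [← insert_endpoints_openSegment] at h
  rcases h with h | h | h
  · exact .inl h
  · exact .inr h
  · have := openSegment_subset_ball_of_ne (Metric.mem_closedBall.2 hx.le)
      (Metric.mem_closedBall.2 hy.le) hxy h
    exact absurd hz (Metric.mem_ball.1 this).ne

/-- Two chords of a circle with a common end do not meet elsewhere. -/
theorem eq_of_mem_segment_of_mem_segment {c x y y' z : EuclideanSpace ℝ (Fin 2)} {r : ℝ}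
    (hx : Dist.dist x c = r) (hy : Dist.dist y c = r) (hy' : Dist.dist y' c = r) (hne : y ≠ y')
    (h : z ∈ segment ℝ x y) (h' : z ∈ segment ℝ x y') : z = x := by
  obtain ⟨s, hs, rfl⟩ := (segment_eq_image_lineMap ℝ x y).subset h
  obtain ⟨t, ht, hst⟩ := (segment_eq_image_lineMap ℝ x y').subset h'
  have key : ∀ {y y' : EuclideanSpace ℝ (Fin 2)} {s t : ℝ}, Dist.dist y c = r → Dist.dist y' c = r →
      y ≠ y' → s ∈ Set.Icc (0 : ℝ) 1 → t ∈ Set.Icc (0 : ℝ) 1 → s ≤ t →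
      AffineMap.lineMap x y s = AffineMap.lineMap x y' t → (AffineMap.lineMap x y s : _) = x := by
    intro y y' s t hy hy' hne hs ht hst h
    rcases ht.1.eq_or_lt with h0 | h0
    · rw [h, ← h0, AffineMap.lineMap_apply_zero]
    -- As `s ≤ t`, the end `y'` lies on the chord from `x` to `y`, hence is one of its ends.
    have hy'' : y' = AffineMap.lineMap x y (s / t) := by
      simp only [AffineMap.lineMap_apply, vsub_eq_sub, vadd_eq_add, add_left_inj] at h ⊢
      rw [div_eq_inv_mul, mul_smul, h, smul_smul, inv_mul_cancel₀ h0.ne', one_smul,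
        sub_add_cancel]
    have hmem : y' ∈ segment ℝ x y := by
      rw [segment_eq_image_lineMap]
      exact ⟨s / t, ⟨div_nonneg hs.1 ht.1, div_le_one_of_le₀ hst ht.1⟩, hy''.symm⟩
    rcases eq_or_eq_of_mem_segment_of_dist_eq hx hy hy' hmem with rfl | rfl
    · rw [h, AffineMap.lineMap_same_apply]
    · exact absurd rfl hne
  rcases le_total s t with hle | hle
  · exact key hy hy' hne hs ht hle hst.symm
  · rw [← hst]
    exact key hy' hy hne.symm ht hs hle hst

end Arcs

/-! ### Planarity of the contraction -/

namespace Truncation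

variable {V : Type u} {W : Type v} {G : SimpleGraph V} (T : Truncation G W)

theorem edge_eq_iff (u v : V) : s(u, T.mate u) = s(v, T.mate v) ↔ u = v ∨ u = T.mate v := by
  rw [Sym2.eq_iff]
  constructor
  · rintro (h | h)
    · exact .inl h.1
    · exact .inr h.1
  · rintro (rfl | rfl)
    · exact .inl ⟨rfl, rfl⟩
    · exact .inr ⟨rfl, T.mate_mate v⟩

theorem base_edge_eq_iff (hT : T.IsSimple) (u v : V) :
    s(T.base u, T.base (T.mate u)) = s(T.base v, T.base (T.mate v)) ↔ u = v ∨ u = T.mate v := by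
  rw [Sym2.eq_iff]
  constructor
  · rintro (h | h)
    · exact .inl (hT u v h.1 h.2)
    · exact .inr (hT u _ h.1 (by rw [T.mate_mate]; exact h.2))
  · rintro (rfl | rfl)
    · exact .inl ⟨rfl, rfl⟩
    · exact .inr ⟨rfl, by rw [T.mate_mate]⟩

/-- Contracting the triangles of a truncation preserves planarity: each triangle is replaced by one
of its corners, together with the two triangle edges at that corner. -/
theorem contraction_isPlanar (hT : T.IsSimple) (hG : G.IsPlanar) : T.contraction.IsPlanar := by
  classical
  obtain ⟨D⟩ := hG
  obtain ⟨b, hb⟩ : ∃ b : W → V, ∀ w, T.base (b w) = w :=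
    ⟨Function.surjInv T.base_surjective, Function.surjInv_eq T.base_surjective⟩
  have binj : Function.Injective b := Function.LeftInverse.injective hb
  -- The leg joins the chosen corner of the triangle to `u`; it shrinks to a point if `u` is that
  -- corner.
  let leg : V → Set (EuclideanSpace ℝ (Fin 2)) := fun u =>
    if b (T.base u) = u then {D.point u} else D.arc s(b (T.base u), u)
  have leg_pos : ∀ u, b (T.base u) = u → leg u = {D.point u} := fun u h => if_pos h
  have leg_neg : ∀ u, b (T.base u) ≠ u → leg u = D.arc s(b (T.base u), u) := fun u h => if_neg h
  have leg_adj : ∀ u, b (T.base u) ≠ u → G.Adj (b (T.base u)) u := fun u h =>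
    T.adj_of_base_eq h (hb _)
  have mate_adj := T.adj_mate
  have leg_point : ∀ u v, D.point v ∈ leg u → v = u ∨ v = b (T.base u) := by
    intro u v hv
    by_cases hu : b (T.base u) = u
    · rw [leg_pos u hu] at hv
      exact .inl (D.point_injective hv)
    · rw [leg_neg u hu] at hv
      exact (Sym2.mem_iff.1 (D.mem_of_point_mem _ (leg_adj u hu) v hv)).symm
  have arc_point : ∀ u v, D.point v ∈ D.arc s(u, T.mate u) → v = u ∨ v = T.mate u :=
    fun u v hv => Sym2.mem_iff.1 (D.mem_of_point_mem _ (mate_adj u) v hv)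
  have leg_leg : ∀ u v z, u ≠ v → z ∈ leg u → z ∈ leg v →
      T.base u = T.base v ∧ z = D.point (b (T.base u)) := by
    intro u v z huv hu hv
    by_cases h1 : b (T.base u) = u
    · have hz := hu
      rw [leg_pos u h1] at hz
      obtain rfl := hz
      rcases leg_point v u hv with h | h
      · exact absurd h huv
      · have : T.base u = T.base v := by rw [h, hb]
        exact ⟨this, by rw [h1]⟩
    by_cases h2 : b (T.base v) = v
    · have hz := hv
      rw [leg_pos v h2] at hz
      obtain rfl := hz
      rcases leg_point u v hu with h | h
      · exact absurd h.symm huv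
      · have : T.base v = T.base u := by rw [h, hb]
        exact ⟨this.symm, by rw [← h]⟩
    rw [leg_neg u h1] at hu
    rw [leg_neg v h2] at hv
    have hne : s(b (T.base u), u) ≠ s(b (T.base v), v) := by
      intro h
      rcases Sym2.eq_iff.1 h with h | h
      · exact huv h.2
      · have : T.base u = T.base v := by rw [h.2, hb]
        exact h1 (by rw [this, ← h.2])
    obtain ⟨w, hw1, hw2, rfl⟩ := D.arc_inter _ (leg_adj u h1) _ (leg_adj v h2) hne z ⟨hu, hv⟩
    rcases Sym2.mem_iff.1 hw1 with rfl | rfl <;> rcases Sym2.mem_iff.1 hw2 with h | h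
    · exact ⟨binj h, rfl⟩
    · have : T.base u = T.base v := by rw [← h, hb]
      exact ⟨this, rfl⟩
    · have : T.base w = T.base v := by rw [h, hb]
      exact absurd (by rw [this, h]) h1
    · exact absurd h huv
  have leg_arc : ∀ u c z, z ∈ leg u → z ∈ D.arc s(c, T.mate c) →
      (z = D.point (b (T.base u)) ∧ (b (T.base u) = c ∨ b (T.base u) = T.mate c)) ∨
        (z = D.point u ∧ (u = c ∨ u = T.mate c)) := by
    intro u c z hu hc
    by_cases h1 : b (T.base u) = u
    · rw [leg_pos u h1] at hu
      obtain rfl := hu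
      exact .inr ⟨rfl, arc_point c u hc⟩
    rw [leg_neg u h1] at hu
    have hne : s(b (T.base u), u) ≠ s(c, T.mate c) := by
      intro h
      rcases Sym2.eq_iff.1 h with h | h
      · exact T.base_mate c (by rw [← h.2, ← h.1, hb])
      · exact T.base_mate c (by rw [← h.1, ← h.2, hb])
    obtain ⟨w, hw1, hw2, rfl⟩ := D.arc_inter _ (leg_adj u h1) _ (mate_adj c) hne z ⟨hu, hc⟩
    rw [Sym2.mem_iff] at hw2
    rcases Sym2.mem_iff.1 hw1 with rfl | rfl
    · exact .inl ⟨rfl, hw2⟩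
    · exact .inr ⟨rfl, hw2⟩
  have arc_arc : ∀ u v z, z ∈ D.arc s(u, T.mate u) → z ∈ D.arc s(v, T.mate v) →
      u = v ∨ u = T.mate v := by
    intro u v z hu hv
    by_contra hn
    obtain ⟨w, hw1, hw2, -⟩ := D.arc_inter _ (mate_adj u) _ (mate_adj v)
      ((T.edge_eq_iff u v).not.2 hn) z ⟨hu, hv⟩
    rcases Sym2.mem_iff.1 hw1 with rfl | rfl <;> rcases Sym2.mem_iff.1 hw2 with h | h
    · exact hn (.inl h)
    · exact hn (.inr h)
    · exact hn (.inr (by rw [← h, T.mate_mate]))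
    · exact hn (.inl (T.mate_injective h))
  have arc_swap : ∀ u, D.arc s(T.mate u, T.mate (T.mate u)) = D.arc s(u, T.mate u) := fun u => by
    rw [T.mate_mate, Sym2.eq_swap]
  let A : V → Set (EuclideanSpace ℝ (Fin 2)) := fun u =>
    leg u ∪ D.arc s(u, T.mate u) ∪ leg (T.mate u)
  have A_mate : ∀ u, A (T.mate u) = A u := fun u => by
    simp only [A, arc_swap]
    rw [T.mate_mate, Set.union_assoc, Set.union_comm, Set.union_comm (D.arc _)]
  have A_cases : ∀ u z, z ∈ A u → (∃ w, (w = u ∨ w = T.mate u) ∧ z ∈ leg w) ∨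
      z ∈ D.arc s(u, T.mate u) := by
    rintro u z ((h | h) | h)
    exacts [.inl ⟨u, .inl rfl, h⟩, .inr h, .inl ⟨_, .inr rfl, h⟩]
  have A_isArc : ∀ u, IsArcBetween (D.point (b (T.base u))) (D.point (b (T.base (T.mate u))))
      (A u) := by
    intro u
    have m := D.isArc _ _ (mate_adj u)
    have l : IsArcBetween (D.point (b (T.base u))) (D.point (T.mate u))
        (leg u ∪ D.arc s(u, T.mate u)) := by
      by_cases h : b (T.base u) = u
      · rw [leg_pos u h, h, Set.union_eq_self_of_subset_left]
        · exact m
        · obtain ⟨γ, -, hγ⟩ := m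
          rw [Set.singleton_subset_iff, ← hγ]
          exact ⟨0, γ.source⟩
      · have l := D.isArc _ _ (leg_adj u h)
        rw [← leg_neg u h] at l
        refine l.trans m fun p hp hp' => ?_
        rcases leg_arc u u p hp hp' with ⟨-, h' | h'⟩ | h'
        · exact absurd h' h
        · exact absurd (by rw [← h', hb]) (T.base_mate u)
        · exact h'.1
    by_cases h : b (T.base (T.mate u)) = T.mate u
    · simp only [A]
      rw [leg_pos _ h, h, Set.union_eq_self_of_subset_right]
      · exact l
      · obtain ⟨γ, -, hγ⟩ := l
        rw [Set.singleton_subset_iff, ← hγ]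
        exact ⟨1, γ.target⟩
    · have r := (D.isArc _ _ (leg_adj _ h)).symm
      rw [← leg_neg _ h] at r
      refine l.trans r fun p hp hp' => ?_
      rcases hp with hp | hp
      · exact absurd (leg_leg _ _ p (mate_adj u).ne hp hp').1.symm (T.base_mate u)
      · rcases leg_arc _ u p hp' hp with ⟨-, h' | h'⟩ | h'
        · exact absurd (by rw [← hb (T.base (T.mate u)), h']) (T.base_mate u)
        · exact absurd h' h
        · exact h'.1
  -- The union over all corners above `e` needs no choice of an orientation; by simplicity only a
  -- corner and its mate contribute, and they have the same `A`.
  let arc : Sym2 W → Set (EuclideanSpace ℝ (Fin 2)) := fun e =>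
    {z | ∃ u, s(T.base u, T.base (T.mate u)) = e ∧ z ∈ A u}
  have arc_eq : ∀ u, arc s(T.base u, T.base (T.mate u)) = A u := by
    intro u
    ext z
    constructor
    · rintro ⟨v, hv, hz⟩
      rcases (T.base_edge_eq_iff hT v u).1 hv with rfl | rfl
      · exact hz
      · rwa [A_mate] at hz
    · exact fun hz => ⟨u, rfl, hz⟩
  have edge : ∀ e ∈ T.contraction.edgeSet, ∃ u, e = s(T.base u, T.base (T.mate u)) := by
    intro e he
    induction e using Sym2.ind with
    | _ x y =>
      obtain ⟨u, rfl, rfl⟩ := he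
      exact ⟨u, rfl⟩
  refine ⟨⟨fun w => D.point (b w), arc, D.point_injective.comp binj, ?_, ?_, ?_⟩⟩
  · rintro _ _ ⟨u, rfl, rfl⟩
    rw [arc_eq]
    exact A_isArc u
  · intro e he w hw
    obtain ⟨u, rfl⟩ := edge e he
    rw [arc_eq] at hw
    rw [Sym2.mem_iff]
    rcases A_cases u _ hw with ⟨v, hv, hz⟩ | hz
    · have : w = T.base v := by
        rcases leg_point v _ hz with h | h
        · rw [← h, hb]
        · exact binj h
      rcases hv with rfl | rfl
      exacts [.inl this, .inr this]
    · rcases arc_point u _ hz with h | h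
      · exact .inl (by rw [← h, hb])
      · exact .inr (by rw [← h, hb])
  · rintro e he f hf hef z ⟨hze, hzf⟩
    obtain ⟨u, rfl⟩ := edge e he
    obtain ⟨v, rfl⟩ := edge f hf
    rw [ne_eq, T.base_edge_eq_iff hT] at hef
    rw [arc_eq] at hze hzf
    have sep : ∀ w w', (w = u ∨ w = T.mate u) → (w' = v ∨ w' = T.mate v) → w ≠ w' := by
      rintro w w' (rfl | rfl) (rfl | rfl) h
      · exact hef (.inl h)
      · exact hef (.inr h)
      · exact hef (.inr (by rw [← h, T.mate_mate]))
      · exact hef (.inl (T.mate_injective h))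
    have mem : ∀ u w, (w = u ∨ w = T.mate u) → T.base w ∈ s(T.base u, T.base (T.mate u)) := by
      rintro u w (rfl | rfl) <;> simp
    rcases A_cases u _ hze with ⟨w, hw, hz⟩ | hz <;>
      rcases A_cases v _ hzf with ⟨w', hw', hz'⟩ | hz'
    · obtain ⟨h1, h2⟩ := leg_leg w w' z (sep w w' hw hw') hz hz'
      exact ⟨T.base w, mem u w hw, h1 ▸ mem v w' hw', h2.symm⟩
    · rcases leg_arc w v z hz hz' with ⟨h1, h2⟩ | ⟨-, h2⟩
      · exact ⟨T.base w, mem u w hw, by simpa only [hb] using mem v _ h2, h1.symm⟩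
      · exact absurd rfl (sep w w hw h2)
    · rcases leg_arc w' u z hz' hz with ⟨h1, h2⟩ | ⟨-, h2⟩
      · exact ⟨T.base w', by simpa only [hb] using mem u _ h2, mem v w' hw', h1.symm⟩
      · exact absurd rfl (sep w' w' h2 hw')
    · exact absurd (arc_arc u v z hz hz') hef

end Truncation

/-! ### Planarity of truncations -/

/-- A truncation is planar if the triangles can be inscribed in disjoint circles, and the other
edges be drawn outside the circles. -/
theorem Truncation.isPlanar_of_circles {V : Type u} {W : Type v} {G : SimpleGraph V}
    (T : Truncation G W) {p : W → EuclideanSpace ℝ (Fin 2)} {r : ℝ}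
    (hrW : ∀ x y, x ≠ y → 2 * r < Dist.dist (p x) (p y)) {q : V → EuclideanSpace ℝ (Fin 2)}
    (hqr : ∀ v, Dist.dist (q v) (p (T.base v)) = r) (hqinj : Function.Injective q)
    {M : V → Set (EuclideanSpace ℝ (Fin 2))} (hM : ∀ v, IsArcBetween (q v) (q (T.mate v)) (M v))
    (M_mate : ∀ v, M (T.mate v) ⊆ M v)
    (M_near : ∀ v x z, z ∈ M v → Dist.dist z (p x) ≤ r →
      (x = T.base v ∧ z = q v) ∨ (x = T.base (T.mate v) ∧ z = q (T.mate v)))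
    (M_disj : ∀ u v, u ≠ v → u ≠ T.mate v → ∀ z ∈ M u, z ∉ M v) : G.IsPlanar := by
  have near : ∀ z x y, Dist.dist z (p x) ≤ r → Dist.dist z (p y) ≤ r → x = y := by
    intro z x y hzx hzy
    by_contra hne
    have := dist_triangle_left (p x) (p y) z
    linarith [hrW x y hne]
  -- the chords
  have chord_near : ∀ a b z, T.base a = T.base b → z ∈ segment ℝ (q a) (q b) →
      Dist.dist z (p (T.base a)) ≤ r := by
    intro a b z hab hz
    exact Metric.mem_closedBall.1 ((convex_closedBall (p (T.base a)) r).segment_subset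
      (Metric.mem_closedBall.2 (hqr a).le) (Metric.mem_closedBall.2 (by rw [hab]; exact (hqr b).le))
      hz)
  have chord_point : ∀ a b c, T.base a = T.base b → q c ∈ segment ℝ (q a) (q b) →
      c = a ∨ c = b := by
    intro a b c hab h
    have hca : T.base a = T.base c := near (q c) _ _ (chord_near a b _ hab h) (hqr c).le
    rcases eq_or_eq_of_mem_segment_of_dist_eq (hqr a) (by rw [hab]; exact hqr b)
      (by rw [hca]; exact hqr c) h with h | h
    exacts [.inl (hqinj h), .inr (hqinj h)]
  -- A chord inside a triangle, the curve `M` on the other edges; both are independent of the order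
  -- of the ends.
  let arc : Sym2 V → Set (EuclideanSpace ℝ (Fin 2)) := fun e =>
    {z | ∃ a b, s(a, b) = e ∧ ((T.base a = T.base b ∧ z ∈ segment ℝ (q a) (q b)) ∨
      (T.mate a = b ∧ z ∈ M a))}
  have arc_chord : ∀ a b, T.base a = T.base b → arc s(a, b) = segment ℝ (q a) (q b) := by
    intro a b hab
    ext z
    constructor
    · rintro ⟨c, d, hcd, h⟩
      rcases Sym2.eq_iff.1 hcd with ⟨rfl, rfl⟩ | ⟨rfl, rfl⟩ <;> rcases h with h | h
      · exact h.2
      · exact absurd (by rw [h.1, hab]) (T.base_mate c)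
      · rw [segment_symm]; exact h.2
      · exact absurd (by rw [h.1, hab]) (T.base_mate c)
    · exact fun hz => ⟨a, b, rfl, .inl ⟨hab, hz⟩⟩
  have arc_mate : ∀ a, arc s(a, T.mate a) = M a := by
    intro a
    ext z
    constructor
    · rintro ⟨c, d, hcd, h⟩
      rcases Sym2.eq_iff.1 hcd with ⟨rfl, rfl⟩ | ⟨rfl, rfl⟩ <;> rcases h with h | h
      · exact absurd h.1.symm (T.base_mate _)
      · exact h.2
      · exact absurd h.1 (T.base_mate _)
      · exact M_mate _ h.2
    · exact fun hz => ⟨a, _, rfl, .inr ⟨rfl, hz⟩⟩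
  have edge : ∀ e ∈ G.edgeSet, (∃ a b, a ≠ b ∧ T.base a = T.base b ∧ e = s(a, b)) ∨
      ∃ a, e = s(a, T.mate a) := by
    intro e he
    induction e using Sym2.ind with
    | _ x y =>
      rcases (T.adj_iff x y).1 he with h | rfl
      · exact .inl ⟨x, y, h.1, h.2, rfl⟩
      · exact .inr ⟨x, rfl⟩
  have chord_chord : ∀ a b c d z, a ≠ b → c ≠ d → T.base a = T.base b → T.base c = T.base d →
      s(a, b) ≠ s(c, d) → z ∈ segment ℝ (q a) (q b) → z ∈ segment ℝ (q c) (q d) →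
      ∃ v, v ∈ s(a, b) ∧ v ∈ s(c, d) ∧ q v = z := by
    classical
    intro a b c d z hab hcd hab' hcd' hne hz hz'
    have hac : T.base a = T.base c := near z _ _ (chord_near a b z hab' hz)
      (chord_near c d z hcd' hz')
    have common : ∀ x y y', T.base x = T.base a → T.base y = T.base a → T.base y' = T.base a →
        y ≠ y' → z ∈ segment ℝ (q x) (q y) → z ∈ segment ℝ (q x) (q y') → q x = z := by
      intro x y y' h1 h2 h3 h4 h5 h6
      exact (eq_of_mem_segment_of_mem_segment (c := p (T.base a)) (h1 ▸ hqr x) (h2 ▸ hqr y)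
        (h3 ▸ hqr y') (hqinj.ne h4) h5 h6).symm
    by_cases h1 : a = c
    · subst h1
      exact ⟨a, by simp, by simp, common a b d rfl hab'.symm hcd'.symm
        (by rintro rfl; exact hne rfl) hz hz'⟩
    by_cases h2 : a = d
    · subst h2
      rw [segment_symm] at hz'
      exact ⟨a, by simp, by simp, common a b c rfl hab'.symm hcd'
        (by rintro rfl; exact hne Sym2.eq_swap) hz hz'⟩
    by_cases h3 : b = c
    · subst h3
      rw [segment_symm] at hz
      exact ⟨b, by simp, by simp, common b a d hab'.symm rfl (hcd'.symm.trans hab'.symm)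
        h2 hz hz'⟩
    by_cases h4 : b = d
    · subst h4
      rw [segment_symm] at hz hz'
      exact ⟨b, by simp, by simp, common b a c hab'.symm rfl hac.symm h1 hz hz'⟩
    -- Chords without a common end would need four corners in one triangle.
    · obtain ⟨F, hF3, hF⟩ := T.exists_finset_fiber (T.base a)
      have hsub : ({a, b, c, d} : Finset V) ⊆ F := by
        intro x hx
        simp only [Finset.mem_insert, Finset.mem_singleton] at hx
        rw [hF]
        rcases hx with rfl | rfl | rfl | rfl
        exacts [rfl, hab'.symm, hac.symm, hcd'.symm.trans hac.symm]
      have := Finset.card_le_card hsub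
      rw [hF3, Finset.card_insert_of_notMem (by simp [hab, h1, h2]),
        Finset.card_insert_of_notMem (by simp [h3, h4]), Finset.card_pair hcd] at this
      omega
  have chord_mate : ∀ a b c z, T.base a = T.base b → z ∈ segment ℝ (q a) (q b) → z ∈ M c →
      ∃ v, v ∈ s(a, b) ∧ v ∈ s(c, T.mate c) ∧ q v = z := by
    intro a b c z hab hz hz'
    rcases M_near c _ z hz' (chord_near a b z hab hz) with ⟨-, rfl⟩ | ⟨-, rfl⟩
    · exact ⟨c, Sym2.mem_iff.2 (chord_point a b c hab hz), by simp, rfl⟩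
    · exact ⟨_, Sym2.mem_iff.2 (chord_point a b _ hab hz), by simp, rfl⟩
  refine ⟨⟨q, arc, hqinj, ?_, ?_, ?_⟩⟩
  · intro a b hab
    rcases (T.adj_iff a b).1 hab with ⟨hne, h⟩ | rfl
    · rw [arc_chord a b h]
      exact isArcBetween_segment (hqinj.ne hne)
    · rw [arc_mate]
      exact hM a
  · intro e he v hv
    rcases edge e he with ⟨a, b, -, hab, rfl⟩ | ⟨a, rfl⟩
    · rw [arc_chord a b hab] at hv
      exact Sym2.mem_iff.2 (chord_point a b v hab hv)
    · rw [arc_mate] at hv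
      rw [Sym2.mem_iff]
      rcases M_near a _ _ hv (hqr v).le with h | h
      · exact .inl (hqinj h.2)
      · exact .inr (hqinj h.2)
  · rintro e he f hf hef z ⟨hz, hz'⟩
    rcases edge e he with ⟨a, b, hne, hab, rfl⟩ | ⟨a, rfl⟩ <;>
      rcases edge f hf with ⟨c, d, hne', hcd, rfl⟩ | ⟨c, rfl⟩
    · rw [arc_chord a b hab] at hz
      rw [arc_chord c d hcd] at hz'
      exact chord_chord a b c d z hne hne' hab hcd hef hz hz'
    · rw [arc_chord a b hab] at hz
      rw [arc_mate] at hz'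
      exact chord_mate a b c z hab hz hz'
    · rw [arc_chord c d hcd] at hz'
      rw [arc_mate] at hz
      obtain ⟨v, h1, h2, h3⟩ := chord_mate c d a z hcd hz' hz
      exact ⟨v, h2, h1, h3⟩
    · rw [arc_mate] at hz hz'
      rw [ne_eq, T.edge_eq_iff, not_or] at hef
      exact absurd hz' (M_disj a c hef.1 hef.2 z hz)

open Filter Topology unitInterval in
/-- Small circles around the vertices of a drawing are disjoint, and every edge meets only the
circles around its ends, that of its first end only in its first half. -/
theorem exists_radius {V : Type u} {W : Type v} [Finite V] [Finite W]
    {p : W → EuclideanSpace ℝ (Fin 2)} (hp : Function.Injective p)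
    {γ : V → I → EuclideanSpace ℝ (Fin 2)} (hc : ∀ v, Continuous (γ v)) {a b : V → W}
    (h0 : ∀ v, γ v 0 = p (a v)) (h1 : ∀ v, γ v 1 = p (b v))
    (hv : ∀ v t w, γ v t = p w → t = 0 ∨ t = 1) :
    ∃ r : ℝ, 0 < r ∧ (∀ x y, x ≠ y → 2 * r < Dist.dist (p x) (p y)) ∧
      ∀ v x (t : I), (x = a v → (1 / 2 : ℝ) ≤ t) → (x = b v → (t : ℝ) ≤ 1 / 2) →
        r < Dist.dist (γ v t) (p x) := by
  have e1 : ∀ᶠ r : ℝ in 𝓝[>] 0, ∀ x y, x ≠ y → 2 * r < Dist.dist (p x) (p y) := by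
    rw [eventually_all]; intro x
    rw [eventually_all]; intro y
    by_cases hxy : x = y
    · exact Eventually.of_forall fun r h => absurd hxy h
    · have hd : 0 < Dist.dist (p x) (p y) / 2 := half_pos (dist_pos.2 (hp.ne hxy))
      filter_upwards [Ioo_mem_nhdsGT hd] with r hr _
      linarith [hr.2]
  have e2 : ∀ᶠ r : ℝ in 𝓝[>] 0, ∀ v x, ∀ t : I, (x = a v → (1 / 2 : ℝ) ≤ t) →
      (x = b v → (t : ℝ) ≤ 1 / 2) → r < Dist.dist (γ v t) (p x) := by
    rw [eventually_all]; intro v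
    rw [eventually_all]; intro x
    -- A compact set of times that omits `0` if `x` is the first end and `1` if it is the last one;
    -- so its image is closed and misses `p x`.
    set K : Set I := {t | (x = a v → (1 / 2 : ℝ) ≤ t) ∧
      (x = b v → (t : ℝ) ≤ 1 / 2)} with hK
    have hKc : IsClosed K := by
      have c1 : IsClosed {t : I | x = a v → (1 / 2 : ℝ) ≤ t} := by
        by_cases h : x = a v
        · simpa [h] using isClosed_le continuous_const continuous_subtype_val
        · simp [h]
      have c2 : IsClosed {t : I | x = b v → (t : ℝ) ≤ 1 / 2} := by
        by_cases h : x = b v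
        · simpa [h] using isClosed_le continuous_subtype_val continuous_const
        · simp [h]
      exact c1.inter c2
    have him : IsClosed (γ v '' K) := (hKc.isCompact.image (hc v)).isClosed
    have hxK : p x ∈ (γ v '' K)ᶜ := by
      rintro ⟨t, ht, htx⟩
      rcases hv v t x htx with rfl | rfl
      · have := ht.1 (hp (htx.symm.trans (h0 v)))
        norm_num at this
      · have := ht.2 (hp (htx.symm.trans (h1 v)))
        norm_num at this
    obtain ⟨ε, hε, hball⟩ := Metric.isOpen_iff.1 him.isOpen_compl _ hxK
    filter_upwards [Ioo_mem_nhdsGT hε] with r hr t ht ht'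
    by_contra! hle
    exact hball (Metric.mem_ball.2 (hle.trans_lt hr.2)) ⟨t, ⟨ht, ht'⟩, rfl⟩
  obtain ⟨r, ⟨h1, h2⟩, h3⟩ := ((e1.and e2).and self_mem_nhdsWithin).exists
  exact ⟨r, h3, h1, h2⟩

open unitInterval in
/-- A curve that starts in the center of a circle and ends outside has a last point on it. -/
theorem exists_last_exit {γ : I → EuclideanSpace ℝ (Fin 2)} (hc : Continuous γ)
    {r : ℝ} (hr0 : 0 < r) (h1r : r < Dist.dist (γ 1) (γ 0)) :
    ∃ τ : I, Dist.dist (γ τ) (γ 0) = r ∧ ∀ t, τ < t → r < Dist.dist (γ t) (γ 0) := by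
  have hd : Continuous fun t => Dist.dist (γ t) (γ 0) := hc.dist continuous_const
  have hZ : IsCompact {t : I | Dist.dist (γ t) (γ 0) ≤ r} :=
    (isClosed_le hd continuous_const).isCompact
  obtain ⟨τ, hτ, hmax⟩ := hZ.exists_isGreatest ⟨0, by simp [hr0.le]⟩
  -- The distance `r` is attained at some time from `τ` on, which by maximality of `τ` is `τ`
  -- itself.
  obtain ⟨t, ht, htr⟩ := intermediate_value_Icc (show τ ≤ 1 from τ.2.2) hd.continuousOn
    ⟨hτ, h1r.le⟩
  have : t = τ := le_antisymm (hmax htr.le) ht.1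
  subst this
  exact ⟨t, htr, fun s hs => not_le.1 fun hle => absurd (hmax hle) (not_le.2 hs)⟩

open unitInterval in
/-- A drawing of the multigraph underlying a truncation yields a drawing of the truncation: every
vertex is replaced by a small circle, every edge is cut off where it leaves the circles around its
ends for good, and the triangles are drawn with chords. -/
theorem Truncation.isPlanar_of_drawing {V : Type u} {W : Type v} {G : SimpleGraph V} [Finite V]
    (T : Truncation G W) (p : W → EuclideanSpace ℝ (Fin 2)) (hp : Function.Injective p)
    (γ : V → I → EuclideanSpace ℝ (Fin 2)) (hc : ∀ v, Continuous (γ v))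
    (hi : ∀ v, Function.Injective (γ v)) (h0 : ∀ v, γ v 0 = p (T.base v))
    (hs : ∀ v t, γ (T.mate v) t = γ v (σ t)) (hv : ∀ v t w, γ v t = p w → t = 0 ∨ t = 1)
    (hx : ∀ u v, u ≠ v → u ≠ T.mate v → ∀ s t, γ u s = γ v t → ∃ w, γ u s = p w) :
    G.IsPlanar := by
  have hW : Finite W := Finite.of_surjective _ T.base_surjective
  have h1 : ∀ v, γ v 1 = p (T.base (T.mate v)) := fun v => by
    rw [← h0, hs, unitInterval.symm_zero]
  obtain ⟨r, hr0, hrW, hrV⟩ := exists_radius hp hc h0 h1 hv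
  have near : ∀ z x y, Dist.dist z (p x) ≤ r → Dist.dist z (p y) ≤ r → x = y := by
    intro z x y hzx hzy
    by_contra hne
    have := dist_triangle_left (p x) (p y) z
    linarith [hrW x y hne]
  have exit : ∀ v, ∃ τ : I, Dist.dist (γ v τ) (p (T.base v)) = r ∧
      ∀ t, τ < t → r < Dist.dist (γ v t) (p (T.base v)) := by
    intro v
    have h1r : r < Dist.dist (γ v 1) (γ v 0) := by
      rw [h0]
      exact hrV v _ 1 (by intro; norm_num) (fun h => absurd h.symm (T.base_mate v))
    simpa only [h0] using exists_last_exit (hc v) hr0 h1r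
  choose τ hτr hτlast using exit
  -- This makes the last exit from the first circle precede the first arrival at the second, so the
  -- middle part `M` is a proper arc.
  have hτhalf : ∀ v, (τ v : ℝ) < 1 / 2 := by
    intro v
    by_contra! hle
    exact (hrV v _ (τ v) (fun _ => hle) (fun h => absurd h.symm (T.base_mate v))).ne' (hτr v)
  have hτlt : ∀ v, τ v < σ (τ (T.mate v)) := by
    intro v
    change (τ v : ℝ) < 1 - τ (T.mate v)
    linarith [hτhalf v, hτhalf (T.mate v)]
  set q : V → EuclideanSpace ℝ (Fin 2) := fun v => γ v (τ v)
  have hqr : ∀ v, Dist.dist (q v) (p (T.base v)) = r := hτr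
  have hq1 : ∀ v, γ v (σ (τ (T.mate v))) = q (T.mate v) := fun v => by
    simp only [q, hs]
  have hqp : ∀ v w, q v ≠ p w := by
    intro v w h
    have hw : w = T.base v := near (q v) w _ (by rw [h, _root_.dist_self]; exact hr0.le) (hqr v).le
    have := hqr v
    rw [h, hw, _root_.dist_self] at this
    exact hr0.ne this
  have hqinj : Function.Injective q := by
    intro u v h
    have hb : T.base u = T.base v := near (q u) _ _ (hqr u).le (by rw [h]; exact (hqr v).le)
    by_contra hne
    obtain ⟨w, hw⟩ := hx u v hne (fun h' => T.base_mate v (by rw [← h', hb])) _ _ h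
    exact hqp u w hw
  -- the middle part of an edge
  set M : V → Set (EuclideanSpace ℝ (Fin 2)) := fun v =>
    γ v '' Set.Icc (τ v) (σ (τ (T.mate v)))
  have M_mate : ∀ v, M (T.mate v) ⊆ M v := by
    rintro v _ ⟨t, ht, rfl⟩
    rw [T.mate_mate] at ht
    refine ⟨σ t, ⟨?_, unitInterval.symm_le_symm.2 ht.1⟩, (hs v t).symm⟩
    exact unitInterval.le_symm_comm.1 ht.2
  have M_near : ∀ v x z, z ∈ M v → Dist.dist z (p x) ≤ r →
      (x = T.base v ∧ z = q v) ∨ (x = T.base (T.mate v) ∧ z = q (T.mate v)) := by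
    rintro v x _ ⟨t, ht, rfl⟩ hz
    by_cases hxv : x = T.base v
    · subst hxv
      left
      have h2 : ¬ τ v < t := fun h => absurd hz (not_le.2 (hτlast v t h))
      rw [le_antisymm (not_lt.1 h2) ht.1]
      exact ⟨rfl, rfl⟩
    by_cases hxm : x = T.base (T.mate v)
    · subst hxm
      right
      have h2 : ¬ τ (T.mate v) < σ t := fun h => by
        have := hτlast _ _ h
        rw [hs, unitInterval.symm_symm] at this
        exact absurd hz (not_le.2 this)
      have h3 : t = σ (τ (T.mate v)) :=
        le_antisymm ht.2 (unitInterval.symm_le_comm.1 (not_lt.1 h2))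
      exact ⟨rfl, by rw [h3, hq1]⟩
    · exact absurd hz (not_le.2 (hrV v x t (fun h => absurd h hxv) (fun h => absurd h hxm)))
  have M_point : ∀ v w, p w ∉ M v := by
    intro v w h
    rcases M_near v w _ h (by rw [_root_.dist_self]; exact hr0.le) with h | h
    · exact hqp _ _ h.2.symm
    · exact hqp _ _ h.2.symm
  refine T.isPlanar_of_circles hrW hqr hqinj (M := M) (fun v => ?_) M_mate M_near ?_
  · rw [← hq1]
    exact isArcBetween_image_Icc (hc v) (hi v) (hτlt v)
  · rintro u v h1 h2 z hz ⟨t, -, hst⟩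
    obtain ⟨s, -, rfl⟩ := id hz
    obtain ⟨w, hw⟩ := hx u v h1 h2 s t hst.symm
    exact M_point u w (hw ▸ hz)

/-- The parametrizations of an arc chosen for the two darts of its edge are unrelated, whereas
`isPlanar_of_drawing` wants one curve run in opposite directions; a numbering of the vertices
selects one of the two. -/
theorem IsCubic.cornerGraph_isPlanar {W : Type v} [Finite W] {H : SimpleGraph W} (hH : H.IsCubic)
    (hP : H.IsPlanar) : H.cornerGraph.IsPlanar := by
  classical
  obtain ⟨D⟩ := hP
  have hfin : Finite H.Dart := Finite.of_injective _ (Dart.toProd_injective (G := H))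
  obtain ⟨n, ⟨φ⟩⟩ := Finite.exists_equiv_fin W
  choose δ hδ hδr using fun d : H.Dart => D.isArc d.fst d.snd d.adj
  -- both darts of an edge use the same parametrization
  let γ : H.Dart → unitInterval → EuclideanSpace ℝ (Fin 2) := fun d t =>
    if φ d.fst < φ d.snd then δ d t else δ d.symm (unitInterval.symm t)
  have hs : ∀ d t, γ d.symm t = γ d (unitInterval.symm t) := by
    intro d t
    have hne : φ d.fst ≠ φ d.snd := φ.injective.ne d.adj.ne
    simp only [γ, unitInterval.symm_symm]
    change (if φ d.snd < φ d.fst then _ else _) = _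
    have hss : ∀ e, e = d → ∀ t, δ e t = δ d t := by rintro _ rfl _; rfl
    rcases lt_or_gt_of_ne hne with h | h
    · rw [if_neg h.not_gt, if_pos h, hss _ d.symm_symm]
    · rw [if_pos h, if_neg h.not_gt]
  have hmem : ∀ d t, γ d t ∈ D.arc d.edge := by
    intro d t
    simp only [γ]
    split_ifs
    · exact (hδr d).subset ⟨t, rfl⟩
    · have := (hδr d.symm).subset ⟨unitInterval.symm t, rfl⟩
      rw [Sym2.eq_swap] at this
      exact this
  have h0 : ∀ d, γ d 0 = D.point d.fst := by
    intro d
    simp only [γ]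
    split_ifs
    · exact (δ d).source
    · rw [unitInterval.symm_zero]; exact (δ d.symm).target
  have hi : ∀ d, Function.Injective (γ d) := by
    intro d
    by_cases h : φ d.fst < φ d.snd
    · simpa only [γ, if_pos h] using hδ d
    · simpa only [γ, if_neg h] using
        show Function.Injective fun t => δ d.symm (unitInterval.symm t) from
          (hδ d.symm).comp unitInterval.symm_bijective.1
  refine hH.truncation.isPlanar_of_drawing D.point D.point_injective γ ?_ hi h0 hs ?_ ?_
  · intro d
    by_cases h : φ d.fst < φ d.snd
    · simpa only [γ, if_pos h] using (δ d).continuous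
    · simpa only [γ, if_neg h] using
        show Continuous fun t => δ d.symm (unitInterval.symm t) from
          (δ d.symm).continuous.comp unitInterval.continuous_symm
  · intro d t w hw
    have hwd := D.mem_of_point_mem d.edge d.edge_mem w (hw ▸ hmem d t)
    rcases Sym2.mem_iff.1 hwd with rfl | rfl
    · exact .inl (hi d (hw.trans (h0 d).symm))
    · right
      apply hi d
      rw [hw, ← unitInterval.symm_zero, ← hs, h0]
      rfl
  · intro d e hde hde' s t hst
    have hne : d.edge ≠ e.edge := fun h => by
      rcases (dart_edge_eq_iff d e).1 h with h | h
      exacts [hde h, hde' h]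
    obtain ⟨w, -, -, hw⟩ := D.arc_inter _ d.edge_mem _ e.edge_mem hne (γ d s)
      ⟨hmem d s, hst ▸ hmem e t⟩
    exact ⟨w, hw.symm⟩

/-- The underlying multigraph has parallel edges and so no `PlaneDrawing`, which is why
`isPlanar_of_drawing` takes one curve per corner. The curves `(s, j * s * (1 - s))` for `j = 0, 1,
2` meet only where `s * (1 - s) = 0`. -/
theorem prism_isPlanar : prism.IsPlanar := by
  -- three parabolas with common ends
  let c : Fin 3 → ℝ → EuclideanSpace ℝ (Fin 2) := fun j s => !₂[s, j.val * (s * (1 - s))]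
  have hc : ∀ i j s t, c i s = c j t → s = t ∧ (i : ℕ) * (s * (1 - s)) = (j : ℕ) * (t * (1 - t)) :=
    fun i j s t h => ⟨by simpa [c] using congrArg (fun x => x 0) h,
      by simpa [c] using congrArg (fun x => x 1) h⟩
  have hcc : ∀ j, Continuous (c j) := fun j => by
    simp only [c]
    fun_prop
  let γ : Fin 2 × Fin 3 → unitInterval → EuclideanSpace ℝ (Fin 2) := fun v t =>
    if v.1 = 0 then c v.2 t else c v.2 (unitInterval.symm t)
  have hγ0 : ∀ j t, γ (0, j) t = c j t := fun j t => rfl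
  have hγ1 : ∀ j t, γ (1, j) t = c j (unitInterval.symm t) := fun j t => rfl
  have two : ∀ i : Fin 2, i = 0 ∨ i = 1 := by decide
  have hγ : ∀ i j t, ∃ s : unitInterval, γ (i, j) t = c j s ∧
      (s = t ∨ s = unitInterval.symm t) := by
    intro i j t
    rcases two i with rfl | rfl
    · exact ⟨t, rfl, .inl rfl⟩
    · exact ⟨_, rfl, .inr rfl⟩
  let p : Fin 2 → EuclideanSpace ℝ (Fin 2) := fun i => c 0 i.val
  have hpc : ∀ i j, p i = c j i.val := by
    intro i j
    rcases two i with rfl | rfl <;> simp [p, c]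
  refine prismTruncation.isPlanar_of_drawing p ?_ γ ?_ ?_ ?_ ?_ ?_ ?_
  · intro i j h
    have := (hc _ _ _ _ h).1
    exact Fin.ext (by exact_mod_cast this)
  · rintro ⟨i, j⟩
    rcases two i with rfl | rfl
    · exact (hcc j).comp continuous_subtype_val
    · exact (hcc j).comp (continuous_subtype_val.comp unitInterval.continuous_symm)
  · rintro ⟨i, j⟩ s t h
    rcases two i with rfl | rfl
    · exact Subtype.ext (hc _ _ _ _ h).1
    · exact unitInterval.symm_bijective.1 (Subtype.ext (hc _ _ _ _ h).1)
  · rintro ⟨i, j⟩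
    change _ = p i
    rw [hpc i j]
    rcases two i with rfl | rfl
    · simp [hγ0]
    · simp [hγ1]
  · rintro ⟨i, j⟩ t
    change γ (1 - i, j) t = _
    rcases two i with rfl | rfl
    · rfl
    · rw [hγ1, unitInterval.symm_symm]; rfl
  · rintro ⟨i, j⟩ t w h
    obtain ⟨s, hs, hst⟩ := hγ i j t
    rw [hs] at h
    have h1 := (hc _ _ _ _ h).1
    have h2 : s = 0 ∨ s = 1 := by
      rcases two w with rfl | rfl
      · exact .inl (Subtype.ext (by simpa using h1))
      · exact .inr (Subtype.ext (by simpa using h1))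
    rcases hst with rfl | rfl
    · exact h2
    · rw [unitInterval.symm_eq_zero, unitInterval.symm_eq_one] at h2
      exact h2.symm
  · rintro ⟨i, j⟩ ⟨k, l⟩ hne hne' s t h
    have hjl : j ≠ l := by
      rintro rfl
      rcases two i with rfl | rfl <;> rcases two k with rfl | rfl
      exacts [hne rfl, hne' rfl, hne' rfl, hne rfl]
    obtain ⟨a, ha, -⟩ := hγ i j s
    obtain ⟨b, hb, -⟩ := hγ k l t
    rw [ha, hb] at h
    rw [ha]
    obtain ⟨h1, h2⟩ := hc _ _ _ _ h
    rw [← h1, mul_eq_mul_right_iff] at h2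
    rcases h2 with h2 | h2
    · exact absurd (Fin.ext (by exact_mod_cast h2)) hjl
    · rcases mul_eq_zero.1 h2 with h3 | h3
      · exact ⟨0, by rw [hpc 0 j, h3]; simp⟩
      · have : (a : ℝ) = 1 := by linarith
        exact ⟨1, by rw [hpc 1 j, this]; simp⟩

/-! ### Invariance under isomorphism -/

section Transfer

variable {V : Type u} {V' : Type v} {G : SimpleGraph V} {G' : SimpleGraph V'}

theorem IsLocallyTriangular.of_iso (h : G.IsLocallyTriangular) (e : G ≃g G') :
    G'.IsLocallyTriangular := by
  intro v
  obtain ⟨a, b, c, hN, hab, hac, hbc⟩ := h (e.symm v)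
  refine ⟨e a, e b, e c, ?_, e.map_adj_iff.2 hab, e.map_adj_iff.not.2 hac, e.map_adj_iff.not.2 hbc⟩
  ext w
  have hw : G'.Adj v w ↔ G.Adj (e.symm v) (e.symm w) := e.symm.map_adj_iff.symm
  have key : ∀ x, e.symm w = x ↔ w = e x := fun x => e.toEquiv.symm_apply_eq
  rw [mem_neighborSet, hw, ← mem_neighborSet, hN]
  simp only [Set.mem_insert_iff, Set.mem_singleton_iff, key]

theorem IsWheel.of_iso (h : G.IsWheel) (e : G ≃g G') : G'.IsWheel := by
  obtain ⟨u, ⟨n, hn, ⟨φ⟩⟩, hu⟩ := h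
  refine ⟨e u, ⟨n, hn, ⟨?_⟩⟩, ?_⟩
  · have i : G.induce {v | v ≠ u} ≃g G'.induce {v | v ≠ e u} :=
      ⟨e.toEquiv.subtypeEquiv fun a => (e.injective.ne_iff (x := a) (y := u)).symm,
        fun {a b} => e.map_adj_iff⟩
    exact i.symm.trans φ
  · have : G'.neighborSet (e u) = e '' G.neighborSet u := by
      ext w
      constructor
      · intro hw
        refine ⟨e.symm w, ?_, e.apply_symm_apply w⟩
        rw [mem_neighborSet, ← e.map_adj_iff, e.apply_symm_apply]
        exact hw
      · rintro ⟨x, hx, rfl⟩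
        exact e.map_adj_iff.2 hx
    rwa [this, e.injective.encard_image]

theorem IsWheelFree.of_iso (h : G.IsWheelFree) (e : G ≃g G') : G'.IsWheelFree := by
  intro S hS
  have i : G.induce (e ⁻¹' S) ≃g G'.induce S :=
    ⟨e.toEquiv.subtypeEquiv fun a => Iff.rfl, fun {a b} => e.map_adj_iff⟩
  exact h _ (hS.of_iso i.symm)

theorem nonempty_lineGraph_iso (e : G ≃g G') : Nonempty (G.lineGraph ≃g G'.lineGraph) := by
  let f := e.toCopy.toLineGraphEmbedding
  refine ⟨⟨Equiv.ofBijective f ⟨f.injective, ?_⟩, fun {a b} => f.map_adj_iff⟩⟩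
  rintro ⟨g, hg⟩
  induction g using Sym2.ind with
  | _ x y =>
    refine ⟨⟨s(e.symm x, e.symm y), e.symm.map_adj_iff.2 hg⟩, Subtype.ext ?_⟩
    change s(e (e.symm x), e (e.symm y)) = _
    rw [e.apply_symm_apply, e.apply_symm_apply]

end Transfer

/-! ### Basic graphs and the equivalence -/

theorem IsBasic.isLineGraph {V : Type u} {G : SimpleGraph V} (h : G.IsBasic) :
    G.IsLineGraph := by
  rcases h with ⟨⟨e⟩⟩ | ⟨W, hW, H, -, -, -, ⟨e⟩⟩
  · let K := completeBipartiteGraph (Fin 2) (Fin 3)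
    -- `IsLineGraph` asks for a root graph in the universe of `V`.
    let K' : SimpleGraph (ULift.{u} (Fin 2 ⊕ Fin 3)) := K.comap Equiv.ulift
    obtain ⟨i⟩ := nonempty_lineGraph_iso (G := K') (G' := K) (Iso.comap Equiv.ulift K)
    exact ⟨_, inferInstance, K', ⟨e.trans i.symm⟩⟩
  · exact ⟨W ⊕ H.edgeSet, inferInstance, H.subdivision, ⟨e⟩⟩

theorem IsBasic.properties {V : Type u} {G : SimpleGraph V} (h : G.IsBasic) :
    G.IsVertexConnected 3 ∧ G.IsPlanar ∧ G.IsLocallyTriangular := by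
  rcases h with ⟨⟨e⟩⟩ | ⟨W, hW, H, h3, hc, hP, ⟨e⟩⟩
  · obtain ⟨i⟩ := nonempty_prism_iso_lineGraph
    have j := i.trans e.symm
    exact ⟨prism_isVertexConnected_three.of_iso j, prism_isPlanar.of_iso j,
      prismTruncation.isLocallyTriangular.of_iso j⟩
  · obtain ⟨i⟩ := nonempty_cornerGraph_iso_lineGraph H
    have j := i.trans e.symm
    have h3' : hc.truncation.contraction.IsVertexConnected 3 := by
      rwa [hc.truncation_contraction]
    exact ⟨(hc.truncation.isVertexConnected_three hc.truncation_isSimple h3').of_iso j,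
      (hc.cornerGraph_isPlanar hP).of_iso j, hc.truncation.isLocallyTriangular.of_iso j⟩

/-- The two kinds of basic graphs correspond to the underlying cubic multigraph being simple or
having parallel edges. -/
theorem IsLocallyTriangular.isBasic {V : Type u} [Finite V] {G : SimpleGraph V}
    (h : G.IsLocallyTriangular) (h3 : G.IsVertexConnected 3) (hP : G.IsPlanar) : G.IsBasic := by
  obtain ⟨W, ⟨T⟩⟩ := h.exists_truncation
  by_cases hT : T.IsSimple
  · obtain ⟨i⟩ := T.nonempty_iso_cornerGraph hT
    obtain ⟨j⟩ := nonempty_cornerGraph_iso_lineGraph T.contraction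
    exact .inr ⟨W, Finite.of_surjective _ T.base_surjective, T.contraction,
      T.contraction_isVertexConnected_three hT h3, T.contraction_isCubic hT,
      T.contraction_isPlanar hT hP, ⟨i.trans j⟩⟩
  · obtain ⟨i⟩ := T.nonempty_prism_iso hT h3
    obtain ⟨j⟩ := nonempty_prism_iso_lineGraph
    exact .inl ⟨i.symm.trans j⟩

end SimpleGraph

theorem theorem2 {V : Type*} [Finite V] (G : SimpleGraph V) :
    List.TFAE [
      G.IsBasic,
      G.IsVertexConnected 3 ∧ G.IsWheelFree ∧ G.IsPlanar ∧ G.IsLineGraph,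
      G.IsVertexConnected 3 ∧ G.IsPlanar ∧ G.IsInducedFree (⊤ : SimpleGraph (Fin 4)) ∧
        G.IsInducedFree SimpleGraph.claw ∧ G.IsInducedFree SimpleGraph.diamond ∧
        G.IsInducedFree SimpleGraph.butterfly] := by
  tfae_have 1 → 2 := fun h =>
    ⟨h.properties.1, h.properties.2.2.isWheelFree, h.properties.2.1, h.isLineGraph⟩
  tfae_have 2 → 3 := by
    rintro ⟨h3, hw, hP, W, -, R, ⟨e⟩⟩
    have hR := ((hw.of_iso e).isLocallyTriangular_lineGraph (h3.of_iso e)).of_iso e.symm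
    exact ⟨h3, hP, hR.isInducedFree_K4, hR.isInducedFree_claw, hR.isInducedFree_diamond,
      hR.isInducedFree_butterfly⟩
  tfae_have 3 → 1 := by
    rintro ⟨h3, hP, hK, hC, hD, hB⟩
    exact (SimpleGraph.isLocallyTriangular_of_free h3 hK hC hD hB).isBasic h3 hP
  tfae_finish
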